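/- There is a universal constant $C>0$ such that the following holds. **Networks.** Let $L\ge 1$ and let $d=d_0,d_1,\dots,d_L=k$ be widths, with $k\ge 2$ classes. For each $i$ let $\sigma_i:\mathbb{R}^{d_i}\to\mathbb{R}^{d_i}$ be $\rho_i$-Lipschitz for the Euclidean norm, with $\sigma_i(0)=0$. The index set $\{1,\dots,L\}$ is split into $S_{\mathbf A}$ (fully connected layers) and $S_{\mathbf W}$ (convolutional layers). A fully connected layer has a weight matrix $C_i=A_i\in\mathbb{R}^{d_i\times d_{i-1}}$. A convolutional layer has $c_i$ filters, the rows $w^1,\dots,w^{c_i}\in\mathbb{R}^{r_i}$ of a weight $W_i\in\mathbb{R}^{c_i\times r_i}$, and each filter performs $m_i=d_i/c_i$ operations: the $q$-th operation of filter $j$ takes the inner product of $w^j$ with the $r_i$ distinct input features selected by a fixed index vector $S_{j,q}$ (not depending on $j$ for a standard convolution). Its unrolled matrix $C_i=\gamma_i(W_i)\in\mathbb{R}^{d_i\times d_{i-1}}$ has the rows $w^1_{S_{1,1}},\dots,w^1_{S_{1,m_i}},w^2_{S_{2,1}},\dots,w^{c_i}_{S_{c_i,m_i}}$, where $w^j_{S_{j,q}}\in\mathbb{R}^{d_{i-1}}$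 carries the entries of $w^j$ at the places $S_{j,q}$ and zeros elsewhere. The network is $$F_{\mathbf C}(x)=\sigma_L(C_L\,\sigma_{L-1}(C_{L-1}\cdots\sigma_1(C_1x)\cdots)),\qquad x\in\mathbb{R}^d .$$ Given real numbers $a_i$ and $s_i>0$, let $\mathcal H$ be the set of all such networks (with the layer types, index vectors and $\sigma_i$ fixed) with $\|A_i\|_F\le a_i$ for $i\in S_{\mathbf A}$, $\|W_i\|_F\le a_i$ for $i\in S_{\mathbf W}$, and $\|C_i\|_\sigma\le s_i$ (spectral norm) for all $i$. The sensitive complexity is $$\mathscr R_{\mathbf C}=\Big(2\prod_{i=1}^L\rho_is_i\Big)\Big(\sum_{i\in S_{\mathbf A}}\frac{d_i^2d_{i-1}^2a_i}{s_i}+\sum_{i\in S_{\mathbf W}}\frac{c_i^2r_i^2a_i\sqrt{d_i/c_i}}{s_i}\Big)L^2 .$$ **Risks.** For a probability distribution $\mathcal D$ on $\mathbb{R}^d\times\{1,\dots,k\}$ let $\mathcal R_{\mathcal D}(f)$ be the $\mathcal D$-probability that $y$ is not the unique maximizer of $j\mapsto f(x)_j$. For $\eta>0$ let $\ell_\eta(f(x),y)=g_\eta\big(-(f(x)_y-\max_{j\ne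 y}f(x)_j)\big)$, where $g_\eta(r)=0$ for $r<-\eta$, $g_\eta(r)=1+r/\eta$ for $-\eta\le r\le0$, and $g_\eta(r)=1$ for $r>0$. For a sample $S=((x_1,y_1),\dots,(x_n,y_n))$ let $\widehat{\mathcal R}_{S,\ell_\eta}(f)=\frac1n\sum_{i=1}^n\ell_\eta(f(x_i),y_i)$, and let $X\in\mathbb{R}^{d\times n}$ be the matrix with columns $x_1,\dots,x_n$. **Bound.** For every $n\ge1$, $\eta>0$, $\delta\in(0,1)$ and every $\mathcal D$, with probability at least $1-\delta$ over an i.i.d. sample $S$ of size $n$ from $\mathcal D$, all $F_{\mathbf C}\in\mathcal H$ satisfy $$\mathcal R_{\mathcal D}(F_{\mathbf C})\le\widehat{\mathcal R}_{S,\ell_\eta}(F_{\mathbf C})+C\left(\Big(\frac{\|X\|_F\,\mathscr R_{\mathbf C}}{\eta}\Big)^{1/4}n^{-5/8}+\sqrt{\frac{\ln(1/\delta)}{n}}\right).$$ -/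

import Mathlib

open MeasureTheory
open scoped NNReal

noncomputable section

namespace ConvNet

/-- The vector space `ℝ^d` with the Euclidean norm. -/
abbrev Vec (d : ℕ) : Type := EuclideanSpace ℝ (Fin d)

open scoped Matrix.Norms.Frobenius in
/-- The Frobenius norm of a real matrix. -/
def frobNorm {m n : ℕ} (M : Matrix (Fin m) (Fin n) ℝ) : ℝ := ‖M‖

open scoped Matrix.Norms.L2Operator in
/-- The spectral norm of a real matrix (largest singular value), i.e. the operator norm
with respect to the Euclidean norms. -/
def specNorm {m n : ℕ} (M : Matrix (Fin m) (Fin n) ℝ) : ℝ := ‖M‖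

/-- The combinatorial data of a convolution operation `ℝ^dIn → ℝ^dOut`: there are `c` filters,
each of total size `r`, and each filter performs `m` operations. The `k`-th operation of filter
`j` selects the `r` distinct input features `S j k 0, …, S j k (r-1)`. In a standard convolution
`S j k` does not depend on `j`; in a depthwise convolution it does. -/
structure ConvPattern (dIn dOut : ℕ) where
  c : ℕ
  r : ℕ
  m : ℕ
  out_eq : dOut = c * m
  S : Fin c → Fin m → Fin r ↪ Fin dIn

/-- The fully connected matrix `γ(W)` generated by the convolutional weight `W`. Its rows are
`w^1_{S_1}, …, w^1_{S_m}, w^2_{S_1}, …, w^c_{S_m}` in this order, where `w^j_{S_k}` has the entry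
`w^j_t` at the place `S_k t` and zeros elsewhere. -/
def ConvPattern.gamma {dIn dOut : ℕ} (P : ConvPattern dIn dOut)
    (W : Matrix (Fin P.c) (Fin P.r) ℝ) : Matrix (Fin dOut) (Fin dIn) ℝ :=
  Matrix.of fun o p =>
    let jk := finProdFinEquiv.symm (Fin.cast P.out_eq o)
    ∑ t : Fin P.r, if P.S jk.1 jk.2 t = p then W jk.1 t else 0

/-- A layer is either fully connected or convolutional. -/
inductive Layer (dIn dOut : ℕ) where
  | dense : Layer dIn dOut
  | conv (P : ConvPattern dIn dOut) : Layer dIn dOut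

/-- The weights of a layer: the full matrix `A`, or the `c` filters `W ∈ ℝ^{c × r}`. -/
def Layer.Weight {dIn dOut : ℕ} : Layer dIn dOut → Type
  | .dense => Matrix (Fin dOut) (Fin dIn) ℝ
  | .conv P => Matrix (Fin P.c) (Fin P.r) ℝ

/-- The unified fully connected matrix of a layer: `C = A`, or `C = γ(W)`. -/
def Layer.matrix {dIn dOut : ℕ} :
    (l : Layer dIn dOut) → l.Weight → Matrix (Fin dOut) (Fin dIn) ℝ
  | .dense, A => A
  | .conv P, W => P.gamma W

/-- The Frobenius norm of the weights of a layer: `‖A‖_F`, or `‖W‖_F`. -/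
def Layer.weightNorm {dIn dOut : ℕ} : (l : Layer dIn dOut) → l.Weight → ℝ
  | .dense, A => frobNorm (m := dOut) (n := dIn) A
  | .conv P, W => frobNorm (m := P.c) (n := P.r) W

/-- The contribution of a layer with norm bounds `a`, `s` to the sensitive complexity. -/
def Layer.term {dIn dOut : ℕ} (l : Layer dIn dOut) (a s : ℝ) : ℝ :=
  match l with
  | .dense => (dOut : ℝ) ^ 2 * (dIn : ℝ) ^ 2 * a / s
  | .conv P => (P.c : ℝ) ^ 2 * (P.r : ℝ) ^ 2 * a * Real.sqrt ((dOut : ℝ) / (P.c : ℝ)) / s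

/-- A convolutional neural network architecture with `L` layers: the widths `d_0, …, d_L`, the
kind of each layer, and the (multivariate) activation functions. The layer with index `i : Fin L`
maps `ℝ^{width i.castSucc}` to `ℝ^{width i.succ}`. -/
structure CNN (L : ℕ) where
  width : Fin (L + 1) → ℕ
  layer : (i : Fin L) → Layer (width i.castSucc) (width i.succ)
  act : (i : Fin L) → Vec (width i.succ) → Vec (width i.succ)

namespace CNN

variable {L : ℕ} (N : CNN L)

/-- The input dimension `d = d_0`. -/
abbrev inDim : ℕ := N.width 0

/-- The number of classes, which is the output dimension `d_L`. -/
abbrev classes : ℕ := N.width (Fin.last L)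

/-- A choice of weights for all layers. -/
abbrev Weights : Type := (i : Fin L) → (N.layer i).Weight

/-- The output of the first `i` layers on the input `x`. -/
def layerOutput (w : N.Weights) (x : Vec N.inDim) : (i : Fin (L + 1)) → Vec (N.width i) :=
  Fin.induction x fun i z =>
    N.act i (WithLp.toLp 2 (((N.layer i).matrix (w i)).mulVec (WithLp.ofLp z)))

/-- The network function `x ↦ σ_L(C_L σ_{L-1}(C_{L-1} ⋯ σ_1(C_1 x) ⋯ ))`. -/
def eval (w : N.Weights) (x : Vec N.inDim) : Vec N.classes :=
  N.layerOutput w x (Fin.last L)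

/-- The weights obey the norm constraints `‖A_i‖_F ≤ a_i` (or `‖W_i‖_F ≤ a_i`) and
`‖C_i‖_σ ≤ s_i` for every layer. -/
def Admissible (a s : Fin L → ℝ) (w : N.Weights) : Prop :=
  ∀ i, (N.layer i).weightNorm (w i) ≤ a i ∧ specNorm ((N.layer i).matrix (w i)) ≤ s i

/-- The sensitive complexity. -/
def sensitiveComplexity (ρ : Fin L → ℝ≥0) (a s : Fin L → ℝ) : ℝ :=
  (2 * ∏ i, (ρ i : ℝ) * s i) * (∑ i, (N.layer i).term (a i) (s i)) * (L : ℝ) ^ 2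

end CNN

/-- The margin `v_y - max_{j ≠ y} v_j` of a score vector `v` at the label `y`. -/
def margin {k : ℕ} (v : Vec k) (y : Fin k) : ℝ := v y - ⨆ j : {j : Fin k // j ≠ y}, v j

/-- The ramp function `g_η`. -/
def ramp (η r : ℝ) : ℝ := if r < -η then 0 else if r ≤ 0 then 1 + r / η else 1

/-- The ramp loss of a score vector `v` at the label `y`. -/
def rampLoss {k : ℕ} (η : ℝ) (v : Vec k) (y : Fin k) : ℝ := ramp η (-(margin v y))

/-- The score vector `v` does not predict `y`: the label `y` is not the unique maximizer of `v`.
Ties count as errors, which is the least favourable convention. -/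
def Misclassified {k : ℕ} (v : Vec k) (y : Fin k) : Prop := ∃ j, j ≠ y ∧ v y ≤ v j

/-- The expected 0-1 risk of the score function `f` under the distribution `D`. -/
def risk {d k : ℕ} (D : Measure (Vec d × Fin k)) (f : Vec d → Vec k) : ℝ :=
  D.real {z | Misclassified (f z.1) z.2}

/-- The empirical ramp-loss risk of the score function `f` on the sample `Z`. -/
def empRampRisk {d k n : ℕ} (η : ℝ) (Z : Fin n → Vec d × Fin k) (f : Vec d → Vec k) : ℝ :=
  (1 / (n : ℝ)) * ∑ i, rampLoss η (f (Z i).1) (Z i).2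

/-- The `d × n` matrix whose columns are the inputs of the sample `Z`. -/
def inputMatrix {d k n : ℕ} (Z : Fin n → Vec d × Fin k) : Matrix (Fin d) (Fin n) ℝ :=
  Matrix.of fun p i => (Z i).1 p

end ConvNet

end

/-! The 0-1 loss is at most the ramp loss (`risk_le_integral`), so it suffices to bound, uniformly
over the class, how far the empirical mean of the ramp loss falls below its expectation. This needs
a metric entropy bound, chaining and concentration.

Entropy: by comparing volumes, a layer with `p` weights of norm at most `a` has a net of at most `(1
+ 2a/ε)^p` points at scale `ε`. The logarithm is weakened to `p √(8a/ε)` (`log_one_add_two_mul_le`),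
which is why squared parameter counts enter the sensitive complexity `R`. A convolution is counted
by its filter weights only, at the price of the factor `√(d_i/c_i)` by which unrolling enlarges the
Frobenius norm (`frobNorm_gamma_le`). Relative errors `τ` in all layers add up to `Lτ` at the output
(`CNN.norm_layerOutput_sub_le`), and Cauchy-Schwarz over the layers costs another `L`. Hence the
losses have entropy at most `√(B/ε)` relative to the envelope `‖x‖`, with `B = 8R/η`
(`CNN.exists_loss_net`).

Chaining: the root `(B/ε)^(1/4)` of the entropy is integrable at `0`, so chaining runs through all
scales (`radSup_le_of_entropy`). On a sample the loss vectors have diameter at most `√n` and `B`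
becomes `B‖X‖_F`. The Rademacher average is thus of order `√n (B‖X‖_F/√n)^(1/4)`, and division by
`n` leaves `n^(-5/8)`.

Concentration: by symmetrization (`integral_maxDev_le`), the maximal deviation minus twice the
empirical Rademacher average has nonpositive mean. McDiarmid's inequality applied to this difference
keeps the bound in terms of the observed sample (`measure_exists_mem_gt_le`). Finite nets at finer
and finer scales carry the result to the whole class (`measure_exists_gt_le`). -/

namespace ConvNet

/-! ### Averages over random signs -/

/-- The value `1` or `-1` of a sign. -/
noncomputable def signVal (b : Bool) : ℝ := if b then 1 else -1

/-- The average of `f` over all sign vectors of length `n`. -/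
noncomputable def signAvg {n : ℕ} (f : (Fin n → Bool) → ℝ) : ℝ :=
  (2 ^ n)⁻¹ * ∑ σ : Fin n → Bool, f σ

/-- The correlation of the vector `v` with a sign vector. -/
noncomputable def signSum {n : ℕ} (σ : Fin n → Bool) (v : Vec n) : ℝ := ∑ i, signVal (σ i) * v i

lemma abs_signVal (b : Bool) : |signVal b| = 1 := by cases b <;> simp [signVal]

lemma signSum_sub {n : ℕ} (σ : Fin n → Bool) (v w : Vec n) :
    signSum σ (v - w) = signSum σ v - signSum σ w := by
  simp [signSum, mul_sub]

lemma signSum_le {n : ℕ} (σ : Fin n → Bool) (v : Vec n) : signSum σ v ≤ √n * ‖v‖ := by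
  have h := Finset.sum_mul_sq_le_sq_mul_sq Finset.univ (fun i => signVal (σ i)) (fun i => v i)
  have h1 : ∀ i, signVal (σ i) ^ 2 = 1 := fun i => by rw [← sq_abs, abs_signVal, one_pow]
  simp only [h1, Finset.sum_const, Finset.card_univ, Fintype.card_fin, nsmul_eq_mul, mul_one] at h
  rw [← EuclideanSpace.real_norm_sq_eq] at h
  refine le_of_abs_le (abs_le_of_sq_le_sq ?_ (by positivity))
  rw [mul_pow, Real.sq_sqrt (Nat.cast_nonneg n)]
  exact h

section signAvg

variable {n : ℕ}

lemma signAvg_mono {f g : (Fin n → Bool) → ℝ} (h : ∀ σ, f σ ≤ g σ) : signAvg f ≤ signAvg g :=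
  mul_le_mul_of_nonneg_left (Finset.sum_le_sum fun σ _ => h σ) (by positivity)

lemma signAvg_add (f g : (Fin n → Bool) → ℝ) :
    signAvg (fun σ => f σ + g σ) = signAvg f + signAvg g := by
  simp [signAvg, Finset.sum_add_distrib, mul_add]

lemma signAvg_sum {ι : Type*} (s : Finset ι) (f : ι → (Fin n → Bool) → ℝ) :
    signAvg (fun σ => ∑ j ∈ s, f j σ) = ∑ j ∈ s, signAvg (f j) := by
  simp only [signAvg, Finset.mul_sum]
  rw [Finset.sum_comm]

lemma signAvg_const (c : ℝ) : signAvg (fun _ : Fin n → Bool => c) = c := by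
  simp [signAvg]

lemma signAvg_not (f : (Fin n → Bool) → ℝ) :
    signAvg (fun σ => f fun i => !σ i) = signAvg f := by
  unfold signAvg
  congr 1
  let e : (Fin n → Bool) ≃ (Fin n → Bool) := Equiv.piCongrRight fun _ => Equiv.boolNot
  exact Equiv.sum_comp e f

lemma signAvg_signSum (v : Vec n) : signAvg (fun σ => signSum σ v) = 0 := by
  have h := signAvg_not (fun σ => signSum σ v)
  have h2 : ∀ σ : Fin n → Bool, signSum (fun i => !σ i) v = -1 * signSum σ v := by
    intro σ
    simp only [signSum, Finset.mul_sum]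
    refine Finset.sum_congr rfl fun i _ => ?_
    cases σ i <;> simp [signVal]
  simp only [h2] at h
  have h3 : signAvg (fun σ => -1 * signSum σ v) = -signAvg (fun σ => signSum σ v) := by
    simp [signAvg]
  linarith

/-- The signs are independent, so the average factors into hyperbolic cosines, and `cosh x ≤ exp (x²
/ 2)`. -/
lemma signAvg_exp (t : ℝ) (v : Vec n) :
    signAvg (fun σ => Real.exp (t * signSum σ v)) ≤ Real.exp (t ^ 2 * ‖v‖ ^ 2 / 2) := by
  have h : signAvg (fun σ => Real.exp (t * signSum σ v)) = ∏ i, Real.cosh (t * v i) := by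
    have h1 : ∀ i, Real.cosh (t * v i)
        = 2⁻¹ * ∑ b : Bool, Real.exp (t * (signVal b * v i)) := by
      intro i
      simp [signVal, Real.cosh_eq]; ring
    simp only [h1, Finset.prod_mul_distrib, Finset.prod_const, Finset.card_univ, Fintype.card_fin]
    rw [Fintype.prod_sum, signAvg, inv_pow]
    congr 1
    refine Finset.sum_congr rfl fun σ _ => ?_
    rw [← Real.exp_sum, signSum, Finset.mul_sum]
  rw [h]
  calc ∏ i, Real.cosh (t * v i) ≤ ∏ i, Real.exp ((t * v i) ^ 2 / 2) :=
        Finset.prod_le_prod (fun i _ => (Real.cosh_pos _).le)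
          fun i _ => Real.cosh_le_exp_half_sq _
    _ = Real.exp (t ^ 2 * ‖v‖ ^ 2 / 2) := by
        rw [← Real.exp_sum, EuclideanSpace.real_norm_sq_eq, Finset.mul_sum, Finset.sum_div]
        simp only [mul_pow]

lemma exp_signAvg_le (f : (Fin n → Bool) → ℝ) :
    Real.exp (signAvg f) ≤ signAvg (fun σ => Real.exp (f σ)) := by
  have h := convexOn_exp.map_sum_le (t := Finset.univ) (w := fun _ : Fin n → Bool => ((2 : ℝ) ^ n)⁻¹)
    (p := f) (fun _ _ => by positivity) (by simp) (by simp)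
  simpa [signAvg, Finset.mul_sum] using h

end signAvg

/-! ### Rademacher averages: Massart's lemma and chaining -/

/-- The Rademacher average (not normalized) of a finite family of vectors. -/
noncomputable def radSup {n : ℕ} {Θ : Type*} (T : Finset Θ) (hT : T.Nonempty) (v : Θ → Vec n) : ℝ :=
  signAvg fun σ => T.sup' hT fun θ => signSum σ (v θ)

/-- Optimization over `t` in the Chernoff argument: `t = √(2l)/r` makes the two terms on the right
equal. For `l = 0` this choice degenerates, and `t = M/r²`, the maximizer of `tM - t²r²/2`, rules
out `M > 0`. -/
lemma le_mul_sqrt_of_forall {M r l : ℝ} (hr : 0 < r) (hl : 0 ≤ l)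
    (h : ∀ t : ℝ, 0 < t → t * M ≤ l + t ^ 2 * r ^ 2 / 2) : M ≤ r * √(2 * l) := by
  rcases hl.eq_or_lt with rfl | hl
  · simp only [mul_zero, Real.sqrt_zero]
    by_contra! hM
    have := h (M / r ^ 2) (by positivity)
    have e : (M / r ^ 2) ^ 2 * r ^ 2 / 2 = M / r ^ 2 * M / 2 := by field_simp
    have : 0 < M / r ^ 2 * M := by positivity
    linarith
  · have hs : 0 < √(2 * l) := Real.sqrt_pos.2 (by linarith)
    have := h (√(2 * l) / r) (by positivity)
    have e : (√(2 * l) / r) ^ 2 * r ^ 2 / 2 = l := by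
      field_simp
      rw [Real.sq_sqrt (by linarith)]
    rw [e] at this
    have h2 : √(2 * l) * M ≤ √(2 * l) * (r * √(2 * l)) := by
      calc √(2 * l) * M = r * (√(2 * l) / r * M) := by field_simp
        _ ≤ r * (l + l) := by gcongr
        _ = r * (√(2 * l) * √(2 * l)) := by rw [Real.mul_self_sqrt (by linarith)]; ring
        _ = _ := by ring
    exact le_of_mul_le_mul_left h2 hs

/-- Massart's finite class lemma. -/
lemma radSup_le_mul_sqrt {n : ℕ} {Θ : Type*} (T : Finset Θ) (hT : T.Nonempty) (v : Θ → Vec n)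
    {r l : ℝ} (hr : 0 < r) (hv : ∀ θ ∈ T, ‖v θ‖ ≤ r) (hl : Real.log T.card ≤ l) :
    radSup T hT v ≤ r * √(2 * l) := by
  have hc : (1 : ℝ) ≤ T.card := by exact_mod_cast hT.card_pos
  have hl0 : 0 ≤ l := (Real.log_nonneg hc).trans hl
  refine le_mul_sqrt_of_forall hr hl0 fun t ht => ?_
  rw [← Real.exp_le_exp]
  calc Real.exp (t * radSup T hT v)
      = Real.exp (signAvg fun σ => t * T.sup' hT fun θ => signSum σ (v θ)) := by
        congr 1
        simp only [radSup, signAvg, Finset.mul_sum]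
        refine Finset.sum_congr rfl fun σ _ => by ring
    _ ≤ signAvg fun σ => Real.exp (t * T.sup' hT fun θ => signSum σ (v θ)) := exp_signAvg_le _
    _ ≤ signAvg fun σ => ∑ θ ∈ T, Real.exp (t * signSum σ (v θ)) := by
        refine signAvg_mono fun σ => ?_
        obtain ⟨θ, hθ, he⟩ := T.exists_mem_eq_sup' hT fun θ => signSum σ (v θ)
        rw [he]
        exact Finset.single_le_sum (f := fun θ => Real.exp (t * signSum σ (v θ)))
          (fun _ _ => (Real.exp_pos _).le) hθ
    _ = ∑ θ ∈ T, signAvg fun σ => Real.exp (t * signSum σ (v θ)) := signAvg_sum _ _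
    _ ≤ ∑ θ ∈ T, Real.exp (t ^ 2 * r ^ 2 / 2) := by
        refine Finset.sum_le_sum fun θ hθ => (signAvg_exp t (v θ)).trans ?_
        gcongr
        exact hv θ hθ
    _ = Real.exp (Real.log T.card) * Real.exp (t ^ 2 * r ^ 2 / 2) := by
        rw [Finset.sum_const, nsmul_eq_mul, Real.exp_log (by linarith)]
    _ ≤ Real.exp (l + t ^ 2 * r ^ 2 / 2) := by
        rw [← Real.exp_add]
        gcongr

/-- Dudley's chaining bound for classes whose metric entropy at scale `ε` is at most `√(B / ε)`. -/
lemma radSup_le_of_entropy {n : ℕ} {Θ : Type*} (T : Finset Θ) (hT : T.Nonempty) (v : Θ → Vec n)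
    {B R : ℝ} (hR : 0 < R) (hdiam : ∀ θ θ', ‖v θ - v θ'‖ ≤ R)
    (hnet : ∀ ε : ℝ, 0 < ε → ∃ N : Finset Θ, (∀ θ, ∃ θ' ∈ N, ‖v θ - v θ'‖ ≤ ε) ∧
      Real.log N.card ≤ √(B / ε)) :
    radSup T hT v ≤ 5 * R * √(√(B / R)) := by
  classical
  obtain ⟨θ₀, hθ₀⟩ := hT
  -- With scales `R / 16 ^ j` the entropy grows by `4` per level and its root by `2`, so the
  -- contributions of the links decay by `8`. At level `0` the diameter bound allows a single point.
  have hex : ∀ j : ℕ, ∃ N : Finset Θ, (∀ θ, ∃ θ' ∈ N, ‖v θ - v θ'‖ ≤ R / 16 ^ j) ∧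
      Real.log N.card ≤ 4 ^ j * √(B / R) ∧ (j = 0 → N.card = 1) := by
    intro j
    rcases j with _ | j
    · exact ⟨{θ₀}, fun θ => ⟨θ₀, by simp, by simpa using hdiam θ θ₀⟩, by simp, by simp⟩
    · obtain ⟨N, h1, h2⟩ := hnet (R / 16 ^ (j + 1)) (by positivity)
      refine ⟨N, h1, h2.trans_eq ?_, by simp⟩
      have : B / (R / 16 ^ (j + 1)) = (4 ^ (j + 1)) ^ 2 * (B / R) := by
        rw [← pow_mul, mul_comm (j + 1) 2, pow_mul]
        norm_num
        field_simp
      rw [this, Real.sqrt_mul (by positivity), Real.sqrt_sq (by positivity)]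
  choose N hN hlog hone using hex
  choose p hpN hp using hN
  have hstep : ∀ j θ, ‖v (p (j + 1) θ) - v (p j θ)‖ ≤ 17 * R / 16 ^ (j + 1) := by
    intro j θ
    have h1 := hp (j + 1) θ
    have h2 := hp j θ
    have e : v (p (j + 1) θ) - v (p j θ) = (v θ - v (p j θ)) - (v θ - v (p (j + 1) θ)) := by abel
    rw [e]
    refine (norm_sub_le _ _).trans ((add_le_add h2 h1).trans_eq ?_)
    rw [pow_succ]; field_simp; norm_num
  -- The links of level `j`. Restricting to pairs of net points that are close keeps the radius
  -- small in Massart's lemma, while the number of pairs is at most the product of the two net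
  -- sizes.
  let P : ℕ → Finset (Θ × Θ) := fun j =>
    (N j ×ˢ N (j + 1)).filter fun q => ‖v q.2 - v q.1‖ ≤ 17 * R / 16 ^ (j + 1)
  have hPmem : ∀ j θ, (p j θ, p (j + 1) θ) ∈ P j := by
    intro j θ
    simp only [P, Finset.mem_filter, Finset.mem_product]
    exact ⟨⟨hpN _ _, hpN _ _⟩, hstep j θ⟩
  have hPne : ∀ j, (P j).Nonempty := fun j => ⟨_, hPmem j θ₀⟩
  set Q := √(B / R) with hQ
  have hQ0 : 0 ≤ Q := Real.sqrt_nonneg _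
  have hPlog : ∀ j, Real.log (P j).card ≤ 2 * 4 ^ (j + 1) * Q := by
    intro j
    have c1 : (0 : ℝ) < (N j).card := by exact_mod_cast Finset.card_pos.2 ⟨_, hpN j θ₀⟩
    have c2 : (0 : ℝ) < (N (j + 1)).card := by exact_mod_cast Finset.card_pos.2 ⟨_, hpN (j + 1) θ₀⟩
    have c3 : (0 : ℝ) < (P j).card := by exact_mod_cast (hPne j).card_pos
    have hle : ((P j).card : ℝ) ≤ (N j).card * (N (j + 1)).card := by
      exact_mod_cast (Finset.card_filter_le _ _).trans_eq (Finset.card_product _ _)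
    calc Real.log (P j).card ≤ Real.log ((N j).card * (N (j + 1)).card) := Real.log_le_log c3 hle
      _ = Real.log (N j).card + Real.log (N (j + 1)).card := Real.log_mul c1.ne' c2.ne'
      _ ≤ 4 ^ j * Q + 4 ^ (j + 1) * Q := add_le_add (hlog _) (hlog _)
      _ ≤ 2 * 4 ^ (j + 1) * Q := by
        have : (0 : ℝ) ≤ 4 ^ j * Q := by positivity
        rw [pow_succ]; linarith
  have hrad : ∀ j, radSup (P j) (hPne j) (fun q => v q.2 - v q.1) ≤ 34 * R * √Q / 8 ^ (j + 1) := by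
    intro j
    refine (radSup_le_mul_sqrt (P j) (hPne j) _ (r := 17 * R / 16 ^ (j + 1)) (by positivity)
      (fun q hq => (Finset.mem_filter.1 hq).2) (hPlog j)).trans_eq ?_
    have e : 2 * (2 * 4 ^ (j + 1) * Q) = (2 * 2 ^ (j + 1)) ^ 2 * Q := by
      rw [mul_pow, ← pow_mul, mul_comm (j + 1) 2, pow_mul]; norm_num; ring
    rw [e, Real.sqrt_mul (by positivity), Real.sqrt_sq (by positivity)]
    have e2 : (16 : ℝ) ^ (j + 1) = 8 ^ (j + 1) * 2 ^ (j + 1) := by rw [← mul_pow]; norm_num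
    rw [e2]; field_simp; ring
  have hp0 : ∀ θ, p 0 θ = p 0 θ₀ := by
    intro θ
    obtain ⟨x, hx⟩ := Finset.card_eq_one.1 (hone 0 rfl)
    have h1 := hpN 0 θ
    have h2 := hpN 0 θ₀
    rw [hx, Finset.mem_singleton] at h1 h2
    rw [h1, h2]
  have htel : ∀ J θ, v θ - v (p 0 θ)
      = ∑ j ∈ Finset.range J, (v (p (j + 1) θ) - v (p j θ)) + (v θ - v (p J θ)) := by
    intro J θ
    rw [Finset.sum_range_sub (fun j => v (p j θ))]; abel
  have key : ∀ J : ℕ, radSup T ⟨θ₀, hθ₀⟩ v ≤ 5 * R * √Q + √n * (R / 16 ^ J) := by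
    intro J
    have hpt : ∀ σ : Fin n → Bool, (T.sup' ⟨θ₀, hθ₀⟩ fun θ => signSum σ (v θ)) ≤
        (signSum σ (v (p 0 θ₀)) + ∑ j ∈ Finset.range J,
          (P j).sup' (hPne j) fun q => signSum σ (v q.2 - v q.1)) + √n * (R / 16 ^ J) := by
      intro σ
      refine Finset.sup'_le _ _ fun θ _ => ?_
      have hs : ∀ w : ℕ → Vec n, signSum σ (∑ j ∈ Finset.range J, w j)
          = ∑ j ∈ Finset.range J, signSum σ (w j) := by
        intro w
        simp only [signSum, WithLp.ofLp_sum, Finset.sum_apply, Finset.mul_sum]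
        rw [Finset.sum_comm]
      have h1 : signSum σ (v θ) = signSum σ (v (p 0 θ₀)) +
          ∑ j ∈ Finset.range J, signSum σ (v (p (j + 1) θ) - v (p j θ)) +
            signSum σ (v θ - v (p J θ)) := by
        have := congrArg (signSum σ) (htel J θ)
        have hadd : ∀ a b : Vec n, signSum σ (a + b) = signSum σ a + signSum σ b := by
          intro a b; simp [signSum, mul_add, Finset.sum_add_distrib]
        rw [hadd, hs, signSum_sub, hp0 θ] at this
        linarith
      rw [h1]
      gcongr with j _
      · exact Finset.le_sup' (fun q : Θ × Θ => signSum σ (v q.2 - v q.1)) (hPmem j θ)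
      · refine (signSum_le _ _).trans ?_
        gcongr
        exact hp J θ
    have hsum : ∑ j ∈ Finset.range J, 34 * R * √Q / 8 ^ (j + 1) ≤ 5 * R * √Q := by
      -- The full geometric series is `34/7`, rounded up to `5`. The factor `1 - 1/8^J` lets the
      -- induction close, as `34/8 ≤ 5 - 5/8`.
      have : ∀ J : ℕ, ∑ j ∈ Finset.range J, 34 * R * √Q / 8 ^ (j + 1)
          ≤ 5 * R * √Q * (1 - 1 / 8 ^ J) := by
        intro J
        induction J with
        | zero => simp
        | succ J ih =>
          rw [Finset.sum_range_succ]
          have h0 : 0 ≤ R * √Q / 8 ^ J := by positivity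
          have e1 : 34 * R * √Q / 8 ^ (J + 1) = 34 / 8 * (R * √Q / 8 ^ J) := by
            rw [pow_succ]; field_simp
          have e2 : 5 * R * √Q * (1 - 1 / 8 ^ J) = 5 * R * √Q - 5 * (R * √Q / 8 ^ J) := by
            field_simp
          have e3 : 5 * R * √Q * (1 - 1 / 8 ^ (J + 1))
              = 5 * R * √Q - 5 / 8 * (R * √Q / 8 ^ J) := by
            rw [pow_succ]; field_simp
          rw [e2] at ih; rw [e1, e3]; linarith
      refine (this J).trans (mul_le_of_le_one_right (by positivity) ?_)
      have : (0 : ℝ) ≤ 1 / 8 ^ J := by positivity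
      linarith
    calc radSup T ⟨θ₀, hθ₀⟩ v ≤ _ := signAvg_mono hpt
      _ = ∑ j ∈ Finset.range J, radSup (P j) (hPne j) (fun q => v q.2 - v q.1)
          + √n * (R / 16 ^ J) := by
        rw [signAvg_add, signAvg_add, signAvg_signSum, zero_add, signAvg_sum, signAvg_const]
        rfl
      _ ≤ _ := by
        gcongr
        exact (Finset.sum_le_sum fun j _ => hrad j).trans hsum
  -- The crude Cauchy-Schwarz remainder vanishes in the limit, so no truncation of the scales
  -- survives.
  have hlim : Filter.Tendsto (fun J : ℕ => 5 * R * √Q + √n * (R / 16 ^ J)) Filter.atTop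
      (nhds (5 * R * √Q + √n * (R * 0))) := by
    refine tendsto_const_nhds.add (tendsto_const_nhds.mul ?_)
    simp only [div_eq_mul_inv, ← inv_pow]
    exact tendsto_const_nhds.mul (tendsto_pow_atTop_nhds_zero_of_lt_one (by norm_num) (by norm_num))
  simpa using ge_of_tendsto' hlim key

/-! ### Bounded differences -/

section McDiarmid

variable {𝒵 : Type*} [MeasurableSpace 𝒵] {D : Measure 𝒵} [IsProbabilityMeasure D]

lemma integrable_of_abs_le {Ω : Type*} [MeasurableSpace Ω] {μ : Measure Ω} [IsFiniteMeasure μ]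
    {f : Ω → ℝ} {M : ℝ} (hf : Measurable f) (h : ∀ x, |f x| ≤ M) : Integrable f μ :=
  Integrable.of_bound hf.aestronglyMeasurable M (Filter.Eventually.of_forall h)

lemma measurePreserving_cons (n : ℕ) :
    MeasurePreserving (fun p : 𝒵 × (Fin n → 𝒵) => (Fin.cons p.1 p.2 : Fin (n + 1) → 𝒵))
      (D.prod (Measure.pi fun _ => D)) (Measure.pi fun _ => D) := by
  have h := (measurePreserving_piFinSuccAbove (fun _ : Fin (n + 1) => D) 0).symm
  convert! h using 1
  funext p
  simp [MeasurableEquiv.piFinSuccAbove, Fin.insertNthEquiv]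

lemma integral_pi_succ {n : ℕ} {f : (Fin (n + 1) → 𝒵) → ℝ} {M : ℝ} (hf : Measurable f)
    (hM : ∀ Z, |f Z| ≤ M) :
    ∫ Z, f Z ∂Measure.pi (fun _ => D)
      = ∫ Z, ∫ z, f (Fin.cons z Z) ∂D ∂Measure.pi (fun _ => D) := by
  have h := measurePreserving_cons (D := D) n
  rw [← h.map_eq, integral_map h.measurable.aemeasurable hf.aestronglyMeasurable]
  exact integral_prod_symm _ (integrable_of_abs_le (hf.comp h.measurable) fun p => hM _)

/-- The exponential moment form of McDiarmid's bounded differences inequality. -/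
theorem integral_exp_le_of_bounded_differences {n : ℕ} {f : (Fin n → 𝒵) → ℝ} {M c : ℝ}
    (hf : Measurable f) (hM : ∀ Z, |f Z| ≤ M) (hc : 0 ≤ c)
    (hdiff : ∀ Z i z, f (Function.update Z i z) ≤ f Z + c) (t : ℝ) :
    ∫ Z, Real.exp (t * (f Z - ∫ Y, f Y ∂Measure.pi fun _ => D)) ∂Measure.pi (fun _ => D)
      ≤ Real.exp (n * (t ^ 2 * c ^ 2 / 8)) := by
  induction n with
  | zero =>
    have : ∀ Z : Fin 0 → 𝒵, f Z = f finZeroElim := fun Z => congrArg f (Subsingleton.elim _ _)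
    simp [this]
  | succ n ih =>
    have hcons := (measurePreserving_cons (D := D) n).measurable
    -- Averaging out the first coordinate keeps the bounded differences. The induction hypothesis
    -- handles `g`, and Hoeffding's lemma handles the fluctuation of `f` around `g` on each fibre.
    set g : (Fin n → 𝒵) → ℝ := fun Z => ∫ z, f (Fin.cons z Z) ∂D with hg
    have hsec : ∀ Z, Measurable fun z => f (Fin.cons z Z : Fin (n + 1) → 𝒵) := fun Z =>
      (hf.comp hcons).comp (measurable_id.prodMk measurable_const)
    have hint : ∀ Z, Integrable (fun z => f (Fin.cons z Z : Fin (n + 1) → 𝒵)) D := fun Z =>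
      integrable_of_abs_le (hsec Z) fun _ => hM _
    have hgm : Measurable g :=
      ((hf.comp hcons).stronglyMeasurable.integral_prod_left' (μ := D)).measurable
    have hgM : ∀ Z, |g Z| ≤ M := fun Z => by
      have := norm_integral_le_of_norm_le_const (μ := D)
        (f := fun z => f (Fin.cons z Z : Fin (n + 1) → 𝒵)) (Filter.Eventually.of_forall fun z => hM _)
      simpa using this
    have hgd : ∀ Z i z, g (Function.update Z i z) ≤ g Z + c := by
      intro Z i z
      have : g Z + c = ∫ y, (f (Fin.cons y Z) + c) ∂D := by
        rw [integral_add (hint Z) (integrable_const c)]; simp [hg]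
      rw [this]
      refine integral_mono (hint _) ((hint Z).add (integrable_const c)) fun y => ?_
      have := hdiff (Fin.cons y Z) i.succ z
      rwa [← Fin.cons_update] at this
    have hEf : ∫ Y, f Y ∂Measure.pi (fun _ => D) = ∫ Y, g Y ∂Measure.pi (fun _ => D) :=
      integral_pi_succ hf hM
    set E := ∫ Y, g Y ∂Measure.pi (fun _ => D) with hE
    have hEM : |E| ≤ M := by
      have := norm_integral_le_of_norm_le_const (μ := Measure.pi fun _ : Fin n => D)
        (f := g) (Filter.Eventually.of_forall fun z => hgM _)
      simpa using this
    have hexpb : ∀ x : ℝ, |x| ≤ M → |Real.exp (t * (x - E))| ≤ Real.exp (|t| * (M + M)) := by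
      intro x hx
      rw [abs_of_pos (Real.exp_pos _), Real.exp_le_exp]
      refine (le_abs_self _).trans ?_
      rw [abs_mul]
      gcongr
      exact (abs_sub _ _).trans (add_le_add hx hEM)
    rw [hEf, integral_pi_succ (M := Real.exp (|t| * (M + M)))
      ((hf.sub_const E).const_mul t).exp fun Z => hexpb _ (hM Z)]
    have hinner : ∀ Z : Fin n → 𝒵, ∫ z, Real.exp (t * (f (Fin.cons z Z) - E)) ∂D
        ≤ Real.exp (t ^ 2 * c ^ 2 / 8) * Real.exp (t * (g Z - E)) := by
      intro Z
      have : Nonempty 𝒵 := nonempty_of_isProbabilityMeasure D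
      have hbdd : BddBelow (Set.range fun z => f (Fin.cons z Z : Fin (n + 1) → 𝒵)) :=
        ⟨-M, by rintro _ ⟨z, rfl⟩; exact (abs_le.1 (hM _)).1⟩
      -- Any two values on the fibre differ by at most `c`, so the fibre takes its values in `[b, b
      -- + c]`.
      set b := ⨅ z, f (Fin.cons z Z : Fin (n + 1) → 𝒵) with hb
      have hmem : ∀ z, f (Fin.cons z Z : Fin (n + 1) → 𝒵) ∈ Set.Icc b (b + c) := by
        refine fun z => ⟨ciInf_le hbdd z, ?_⟩
        rw [← sub_le_iff_le_add]
        refine le_ciInf fun y => ?_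
        have := hdiff (Fin.cons y Z) 0 z
        rw [Fin.update_cons_zero] at this
        linarith
      have hsub := ProbabilityTheory.hasSubgaussianMGF_of_mem_Icc (μ := D)
        (hsec Z).aemeasurable (Filter.Eventually.of_forall hmem)
      have hmgf := hsub.mgf_le t
      have hcc : (((‖b + c - b‖₊ / 2) ^ 2 : ℝ≥0) : ℝ) * t ^ 2 / 2 = t ^ 2 * c ^ 2 / 8 := by
        simp only [add_sub_cancel_left, NNReal.coe_pow, NNReal.coe_div, coe_nnnorm,
          Real.norm_of_nonneg hc, NNReal.coe_ofNat]
        ring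
      rw [hcc] at hmgf
      have hsplit : ∀ z, Real.exp (t * (f (Fin.cons z Z) - E))
          = Real.exp (t * (f (Fin.cons z Z) - g Z)) * Real.exp (t * (g Z - E)) := by
        intro z; rw [← Real.exp_add]; congr 1; ring
      simp only [hsplit]
      rw [integral_mul_const]
      gcongr
      exact hmgf
    calc ∫ Z, ∫ z, Real.exp (t * (f (Fin.cons z Z) - E)) ∂D ∂Measure.pi (fun _ => D)
        ≤ ∫ Z, Real.exp (t ^ 2 * c ^ 2 / 8) * Real.exp (t * (g Z - E))
            ∂Measure.pi (fun _ : Fin n => D) := by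
          refine integral_mono_of_nonneg
            (Filter.Eventually.of_forall fun Z => integral_nonneg fun z => (Real.exp_pos _).le)
            (Integrable.const_mul (integrable_of_abs_le (M := Real.exp (|t| * (M + M)))
              ((hgm.sub_const E).const_mul t).exp fun Z => hexpb _ (hgM Z)) _)
            (Filter.Eventually.of_forall hinner)
      _ = Real.exp (t ^ 2 * c ^ 2 / 8) * ∫ Z, Real.exp (t * (g Z - E))
            ∂Measure.pi (fun _ : Fin n => D) := integral_const_mul _ _
      _ ≤ Real.exp (t ^ 2 * c ^ 2 / 8) * Real.exp (n * (t ^ 2 * c ^ 2 / 8)) := by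
          gcongr
          exact ih hgm hgM hgd
      _ = Real.exp ((n + 1 : ℕ) * (t ^ 2 * c ^ 2 / 8)) := by
          rw [← Real.exp_add]; congr 1; push_cast; ring

/-- McDiarmid's bounded differences inequality. -/
theorem measure_ge_le_of_bounded_differences {n : ℕ} (hn : 0 < n) {f : (Fin n → 𝒵) → ℝ} {M c : ℝ}
    (hf : Measurable f) (hM : ∀ Z, |f Z| ≤ M) (hc : 0 < c)
    (hdiff : ∀ Z i z, f (Function.update Z i z) ≤ f Z + c) {t : ℝ} (ht : 0 ≤ t)
    (hmean : ∫ Y, f Y ∂Measure.pi (fun _ => D) ≤ 0) :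
    Measure.pi (fun _ => D) {Z | t ≤ f Z} ≤ ENNReal.ofReal (Real.exp (-(2 * t ^ 2 / (n * c ^ 2)))) := by
  have hn' : (0 : ℝ) < n := by exact_mod_cast hn
  set μ : Measure (Fin n → 𝒵) := Measure.pi fun _ => D
  set E := ∫ Y, f Y ∂μ
  have hEM : |E| ≤ M := by
    have := norm_integral_le_of_norm_le_const (μ := μ)
      (f := f) (Filter.Eventually.of_forall fun z => hM _)
    simpa using this
  -- The minimizer of the Chernoff exponent `n l² c² / 8 - l t`.
  set l := 4 * t / (n * c ^ 2) with hl
  have hl0 : 0 ≤ l := by positivity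
  have hm := integral_exp_le_of_bounded_differences (D := D) hf hM hc.le hdiff l
  have hint : Integrable (fun Z => Real.exp (l * (f Z - E))) μ := by
    refine integrable_of_abs_le (M := Real.exp (l * (M + M))) ((hf.sub_const E).const_mul l).exp ?_
    intro Z
    rw [abs_of_pos (Real.exp_pos _), Real.exp_le_exp]
    gcongr
    exact (le_abs_self _).trans ((abs_sub _ _).trans (add_le_add (hM Z) hEM))
  have hmarkov := mul_meas_ge_le_integral_of_nonneg (μ := μ)
    (Filter.Eventually.of_forall fun Z => (Real.exp_pos (l * (f Z - E))).le) hint (Real.exp (l * t))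
  have hsub : {Z | t ≤ f Z} ⊆ {Z | Real.exp (l * t) ≤ Real.exp (l * (f Z - E))} := by
    intro Z hZ
    simp only [Set.mem_ofPred_eq, Real.exp_le_exp] at hZ ⊢
    gcongr
    linarith
  rw [← ofReal_measureReal]
  refine ENNReal.ofReal_le_ofReal ?_
  have h1 : Real.exp (l * t) * μ.real {Z | t ≤ f Z} ≤ Real.exp (n * (l ^ 2 * c ^ 2 / 8)) :=
    (mul_le_mul_of_nonneg_left (measureReal_mono hsub) (Real.exp_pos _).le).trans (hmarkov.trans hm)
  have h2 : μ.real {Z | t ≤ f Z} ≤ Real.exp (n * (l ^ 2 * c ^ 2 / 8)) / Real.exp (l * t) := by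
    rw [le_div_iff₀ (Real.exp_pos _)]; linarith
  refine h2.trans_eq ?_
  rw [← Real.exp_sub]
  congr 1
  rw [hl]; field_simp; ring

end McDiarmid

/-! ### Symmetrization and the deviation bound for finite classes -/

lemma abs_sup'_le {Θ : Type*} {T : Finset Θ} (hT : T.Nonempty) {f : Θ → ℝ} {M : ℝ}
    (h : ∀ θ ∈ T, |f θ| ≤ M) : |T.sup' hT f| ≤ M := by
  obtain ⟨θ, hθ, he⟩ := T.exists_mem_eq_sup' hT f
  rw [he]
  exact h θ hθ

lemma measurable_fun_sup' {Ω Θ : Type*} [MeasurableSpace Ω] {T : Finset Θ} (hT : T.Nonempty)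
    {f : Θ → Ω → ℝ} (h : ∀ θ ∈ T, Measurable (f θ)) :
    Measurable fun ω => T.sup' hT fun θ => f θ ω := by
  have := Finset.measurable_sup' hT h
  convert! this using 1
  funext ω
  rw [Finset.sup'_apply]

lemma sum_update_le {n : ℕ} {𝒵 : Type*} {F : Fin n → 𝒵 → ℝ} {c : ℝ}
    (hF : ∀ i z z', F i z ≤ F i z' + c) (Z : Fin n → 𝒵) (i : Fin n) (z : 𝒵) :
    ∑ j, F j (Function.update Z i z j) ≤ ∑ j, F j (Z j) + c := by
  have h : ∀ j, F j (Function.update Z i z j) ≤ F j (Z j) + if j = i then c else 0 := by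
    intro j
    by_cases hj : j = i
    · subst hj; simpa using hF j z (Z j)
    · simp [hj]
  refine (Finset.sum_le_sum fun j _ => h j).trans_eq ?_
  rw [Finset.sum_add_distrib]; simp

section Symmetrization

variable {𝒵 : Type*} [MeasurableSpace 𝒵] {D : Measure 𝒵} [IsProbabilityMeasure D]
  {Θ : Type*} {n : ℕ}

/-- The vector of losses of the hypothesis `θ` on the sample `Z`. -/
noncomputable def lossVec (ℓ : Θ → 𝒵 → ℝ) (Z : Fin n → 𝒵) (θ : Θ) : Vec n :=
  WithLp.toLp 2 fun i => ℓ θ (Z i)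

/-- The largest deviation (not normalized) of the sample mean below the mean. -/
noncomputable def maxDev (D : Measure 𝒵) (ℓ : Θ → 𝒵 → ℝ) (T : Finset Θ) (hT : T.Nonempty)
    (Z : Fin n → 𝒵) : ℝ :=
  T.sup' hT fun θ => ∑ i, (∫ z, ℓ θ z ∂D - ℓ θ (Z i))

variable {ℓ : Θ → 𝒵 → ℝ} (hm : ∀ θ, Measurable (ℓ θ)) (h0 : ∀ θ z, 0 ≤ ℓ θ z)
  (h1 : ∀ θ z, ℓ θ z ≤ 1) (T : Finset Θ) (hT : T.Nonempty)

omit [MeasurableSpace 𝒵] in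
lemma signSum_lossVec (σ : Fin n → Bool) (Z : Fin n → 𝒵) (θ : Θ) :
    signSum σ (lossVec ℓ Z θ) = ∑ i, signVal (σ i) * ℓ θ (Z i) := rfl

omit [MeasurableSpace 𝒵] in
include h0 h1 in
lemma abs_loss_sub_le (θ : Θ) (z z' : 𝒵) : |ℓ θ z - ℓ θ z'| ≤ 1 :=
  abs_le.2 ⟨by linarith [h0 θ z, h1 θ z'], by linarith [h0 θ z', h1 θ z]⟩

include hm h0 h1 in
lemma integral_loss_mem (θ : Θ) : 0 ≤ ∫ z, ℓ θ z ∂D ∧ ∫ z, ℓ θ z ∂D ≤ 1 := by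
  refine ⟨integral_nonneg (h0 θ), ?_⟩
  have hi : Integrable (ℓ θ) D := integrable_of_abs_le (M := 1) (hm θ) fun z => by
    rw [abs_of_nonneg (h0 θ z)]; exact h1 θ z
  have := integral_mono hi (integrable_const (1 : ℝ)) (h1 θ)
  simpa using this

include hm in
lemma measurable_signed_sup (s : Fin n → ℝ) :
    Measurable fun W : Fin n → 𝒵 × 𝒵 =>
      T.sup' hT fun θ => ∑ i, s i * (ℓ θ (W i).2 - ℓ θ (W i).1) := by
  refine measurable_fun_sup' hT fun θ _ => Finset.measurable_fun_sum _ fun i _ => ?_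
  exact (((hm θ).comp (measurable_snd.comp (measurable_pi_apply i))).sub
    ((hm θ).comp (measurable_fst.comp (measurable_pi_apply i)))).const_mul _

omit [MeasurableSpace 𝒵] in
include h0 h1 in
lemma abs_signed_sup_le (s : Fin n → ℝ) (hs : ∀ i, |s i| ≤ 1) (W : Fin n → 𝒵 × 𝒵) :
    |T.sup' hT fun θ => ∑ i, s i * (ℓ θ (W i).2 - ℓ θ (W i).1)| ≤ n := by
  refine abs_sup'_le hT fun θ _ => (Finset.abs_sum_le_sum_abs _ _).trans ?_
  calc ∑ i, |s i * (ℓ θ (W i).2 - ℓ θ (W i).1)| ≤ ∑ _i : Fin n, (1 : ℝ) := by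
        refine Finset.sum_le_sum fun i _ => ?_
        rw [abs_mul]
        exact mul_le_one₀ (hs i) (abs_nonneg _) (abs_loss_sub_le h0 h1 θ _ _)
    _ = n := by simp

include hm in
lemma measurable_radSup : Measurable fun Z : Fin n → 𝒵 => radSup T hT (lossVec ℓ Z) := by
  unfold radSup signAvg
  refine Measurable.const_mul (Finset.measurable_fun_sum _ fun σ _ =>
    measurable_fun_sup' hT fun θ _ => Finset.measurable_fun_sum _ fun i _ => ?_) _
  exact ((hm θ).comp (measurable_pi_apply i)).const_mul _

omit [MeasurableSpace 𝒵] in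
include h0 h1 in
lemma abs_radSup_le (Z : Fin n → 𝒵) : |radSup T hT (lossVec ℓ Z)| ≤ n := by
  have h : ∀ σ : Fin n → Bool, |T.sup' hT fun θ => signSum σ (lossVec ℓ Z θ)| ≤ n := by
    intro σ
    refine abs_sup'_le hT fun θ _ => (Finset.abs_sum_le_sum_abs _ _).trans ?_
    calc ∑ i, |signVal (σ i) * ℓ θ (Z i)| ≤ ∑ _i : Fin n, (1 : ℝ) := by
          refine Finset.sum_le_sum fun i _ => ?_
          rw [abs_mul, abs_signVal, one_mul, abs_of_nonneg (h0 _ _)]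
          exact h1 _ _
      _ = n := by simp
  refine abs_le.2 ⟨?_, ?_⟩
  · rw [← signAvg_const (n := n) (-(n : ℝ))]
    exact signAvg_mono fun σ => (abs_le.1 (h σ)).1
  · rw [← signAvg_const (n := n) (n : ℝ)]
    exact signAvg_mono fun σ => (abs_le.1 (h σ)).2

omit [IsProbabilityMeasure D] in
lemma measurable_maxDev (hm : ∀ θ, Measurable (ℓ θ)) :
    Measurable fun Z : Fin n → 𝒵 => maxDev D ℓ T hT Z :=
  measurable_fun_sup' hT fun θ _ => Finset.measurable_fun_sum _ fun i _ =>
    measurable_const.sub ((hm θ).comp (measurable_pi_apply i))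

include hm h0 h1 in
lemma abs_maxDev_le (Z : Fin n → 𝒵) : |maxDev D ℓ T hT Z| ≤ n := by
  refine abs_sup'_le hT fun θ _ => (Finset.abs_sum_le_sum_abs _ _).trans ?_
  calc ∑ i, |∫ z, ℓ θ z ∂D - ℓ θ (Z i)| ≤ ∑ _i : Fin n, (1 : ℝ) := by
        refine Finset.sum_le_sum fun i _ => ?_
        obtain ⟨a, b⟩ := integral_loss_mem (D := D) hm h0 h1 θ
        exact abs_le.2 ⟨by linarith [h1 θ (Z i)], by linarith [h0 θ (Z i)]⟩
    _ = n := by simp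

include hm h0 h1 in
/-- The maximal deviation is at most the average over an independent ghost sample. -/
lemma maxDev_le_integral (Z : Fin n → 𝒵) :
    maxDev D ℓ T hT Z ≤ ∫ Y, T.sup' hT (fun θ => ∑ i, (ℓ θ (Y i) - ℓ θ (Z i)))
      ∂Measure.pi (fun _ : Fin n => D) := by
  set μ : Measure (Fin n → 𝒵) := Measure.pi fun _ => D
  have hsm : ∀ θ, Measurable fun Y : Fin n → 𝒵 => ∑ i, (ℓ θ (Y i) - ℓ θ (Z i)) := fun θ =>
    Finset.measurable_fun_sum _ fun i _ => ((hm θ).comp (measurable_pi_apply i)).sub_const _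
  have hsb : ∀ θ (Y : Fin n → 𝒵), |∑ i, (ℓ θ (Y i) - ℓ θ (Z i))| ≤ n := by
    intro θ Y
    refine (Finset.abs_sum_le_sum_abs _ _).trans
      ((Finset.sum_le_sum fun i _ => abs_loss_sub_le h0 h1 θ _ _).trans_eq (by simp))
  refine Finset.sup'_le _ _ fun θ hθ => ?_
  have hi : ∀ i, Integrable (fun Y : Fin n → 𝒵 => ℓ θ (Y i)) μ := fun i =>
    integrable_of_abs_le (M := 1) ((hm θ).comp (measurable_pi_apply i)) fun Y => by
      rw [abs_of_nonneg (h0 _ _)]; exact h1 _ _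
  have he : ∑ i, (∫ z, ℓ θ z ∂D - ℓ θ (Z i)) = ∫ Y, ∑ i, (ℓ θ (Y i) - ℓ θ (Z i)) ∂μ := by
    rw [integral_finsetSum (f := fun i (Y : Fin n → 𝒵) => ℓ θ (Y i) - ℓ θ (Z i)) _
      fun i _ => (hi i).sub (integrable_const _)]
    refine Finset.sum_congr rfl fun i _ => ?_
    rw [integral_sub (hi i) (integrable_const _)]
    have hev := measurePreserving_eval (fun _ : Fin n => D) i
    have : ∫ Y, ℓ θ (Y i) ∂μ = ∫ z, ℓ θ z ∂D := by
      rw [← hev.map_eq, integral_map hev.measurable.aemeasurable (hm θ).aestronglyMeasurable]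
    rw [this]; simp
  rw [he]
  refine integral_mono (integrable_of_abs_le (hsm θ) (hsb θ))
    (integrable_of_abs_le (M := n) (measurable_fun_sup' hT fun θ _ => hsm θ)
      fun Y => abs_sup'_le hT fun θ _ => hsb θ Y) fun Y => ?_
  exact Finset.le_sup' (fun θ => ∑ i, (ℓ θ (Y i) - ℓ θ (Z i))) hθ

-- Exchanging the two members of the pairs whose sign is `-1` preserves the product measure and
-- flips exactly those signs.
include hm in
lemma integral_signed_sup_eq (σ : Fin n → Bool) :
    ∫ W, T.sup' hT (fun θ => ∑ i, signVal (σ i) * (ℓ θ (W i).2 - ℓ θ (W i).1))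
        ∂Measure.pi (fun _ : Fin n => D.prod D)
      = ∫ W, T.sup' hT (fun θ => ∑ i, 1 * (ℓ θ (W i).2 - ℓ θ (W i).1))
        ∂Measure.pi (fun _ : Fin n => D.prod D) := by
  have hsw : ∀ i, MeasurePreserving (if σ i then id else Prod.swap : 𝒵 × 𝒵 → 𝒵 × 𝒵)
      (D.prod D) (D.prod D) := by
    intro i
    split_ifs
    · exact MeasurePreserving.id _
    · exact Measure.measurePreserving_swap
  have hp := measurePreserving_pi (fun _ : Fin n => D.prod D) (fun _ : Fin n => D.prod D) hsw
  conv_rhs => rw [← hp.map_eq]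
  rw [integral_map hp.measurable.aemeasurable
    (measurable_signed_sup hm T hT fun _ => 1).aestronglyMeasurable]
  refine integral_congr_ae (Filter.Eventually.of_forall fun W => ?_)
  refine Finset.sup'_congr hT rfl fun θ _ => Finset.sum_congr rfl fun i _ => ?_
  cases h : σ i <;> simp [signVal, h]

include hm h0 h1 in
/-- Symmetrization: the expected maximal deviation is at most twice the expected Rademacher
average. -/
theorem integral_maxDev_le :
    ∫ Z, maxDev D ℓ T hT Z ∂Measure.pi (fun _ : Fin n => D)
      ≤ ∫ Z, 2 * radSup T hT (lossVec ℓ Z) ∂Measure.pi (fun _ : Fin n => D) := by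
  set μ : Measure (Fin n → 𝒵) := Measure.pi fun _ => D with hμ
  set ν : Measure (Fin n → 𝒵 × 𝒵) := Measure.pi fun _ => D.prod D with hν
  set S : (Fin n → ℝ) → (Fin n → 𝒵 × 𝒵) → ℝ := fun s W =>
    T.sup' hT fun θ => ∑ i, s i * (ℓ θ (W i).2 - ℓ θ (W i).1) with hS
  have hSi : ∀ s : Fin n → ℝ, (∀ i, |s i| ≤ 1) → Integrable (S s) ν := fun s hs =>
    integrable_of_abs_le (measurable_signed_sup hm T hT s) (abs_signed_sup_le h0 h1 T hT s hs)
  have hsign : ∀ (σ : Fin n → Bool) i, |signVal (σ i)| ≤ 1 := fun σ i => (abs_signVal _).le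
  have hradi : Integrable (fun Z : Fin n → 𝒵 => radSup T hT (lossVec ℓ Z)) μ :=
    integrable_of_abs_le (measurable_radSup hm T hT) (abs_radSup_le h0 h1 T hT)
  have hA : ∫ Z, maxDev D ℓ T hT Z ∂μ ≤ ∫ W, S (fun _ => 1) W ∂ν := by
    have hpr := measurePreserving_arrowProdEquivProdArrow 𝒵 𝒵 (Fin n) (fun _ => D) (fun _ => D)
    set G : (Fin n → 𝒵) × (Fin n → 𝒵) → ℝ := fun p =>
      T.sup' hT fun θ => ∑ i, (ℓ θ (p.2 i) - ℓ θ (p.1 i)) with hG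
    have hGm : Measurable G :=
      measurable_fun_sup' hT fun θ _ => Finset.measurable_fun_sum _ fun i _ =>
        ((hm θ).comp ((measurable_pi_apply i).comp measurable_snd)).sub
          ((hm θ).comp ((measurable_pi_apply i).comp measurable_fst))
    have hGb : ∀ p, |G p| ≤ n := fun p => abs_sup'_le hT fun θ _ =>
      (Finset.abs_sum_le_sum_abs _ _).trans
        ((Finset.sum_le_sum fun i _ => abs_loss_sub_le h0 h1 θ _ _).trans_eq (by simp))
    have hGi : Integrable G (μ.prod μ) := integrable_of_abs_le hGm hGb
    have h2 : ∫ W, S (fun _ => 1) W ∂ν = ∫ p, G p ∂(μ.prod μ) := by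
      rw [← hpr.map_eq, integral_map hpr.measurable.aemeasurable hGm.aestronglyMeasurable]
      refine integral_congr_ae (Filter.Eventually.of_forall fun W => ?_)
      simp only [hS, hG, one_mul]
      rfl
    rw [h2, integral_prod _ hGi]
    exact integral_mono (integrable_of_abs_le (measurable_maxDev T hT hm)
      (abs_maxDev_le hm h0 h1 T hT)) hGi.integral_prod_left
      fun Z => maxDev_le_integral hm h0 h1 T hT Z
  have hB : ∫ W, S (fun _ => 1) W ∂ν
      = ∫ W, signAvg (fun σ : Fin n → Bool => S (fun i => signVal (σ i)) W) ∂ν := by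
    simp only [signAvg]
    rw [integral_const_mul, integral_finsetSum _ fun σ _ => hSi _ (hsign σ)]
    have : ∀ σ : Fin n → Bool, ∫ W, S (fun i => signVal (σ i)) W ∂ν = ∫ W, S (fun _ => 1) W ∂ν :=
      fun σ => integral_signed_sup_eq hm T hT σ
    simp only [this]
    simp
  have hC : ∀ W : Fin n → 𝒵 × 𝒵, signAvg (fun σ : Fin n → Bool => S (fun i => signVal (σ i)) W)
      ≤ radSup T hT (lossVec ℓ fun i => (W i).2) + radSup T hT (lossVec ℓ fun i => (W i).1) := by
    intro W
    -- The first members of the pairs enter with the opposite signs, which have the same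
    -- distribution.
    have e : radSup T hT (lossVec ℓ fun i => (W i).1) = signAvg fun σ => T.sup' hT fun θ =>
        signSum (fun i => !σ i) (lossVec ℓ (fun i => (W i).1) θ) :=
      (signAvg_not fun σ => T.sup' hT fun θ => signSum σ (lossVec ℓ (fun i => (W i).1) θ)).symm
    rw [e, radSup, ← signAvg_add]
    refine signAvg_mono fun σ => Finset.sup'_le _ _ fun θ hθ => ?_
    have h3 : ∑ i, signVal (σ i) * (ℓ θ (W i).2 - ℓ θ (W i).1)
        = signSum σ (lossVec ℓ (fun i => (W i).2) θ)
          + signSum (fun i => !σ i) (lossVec ℓ (fun i => (W i).1) θ) := by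
      rw [signSum_lossVec, signSum_lossVec, ← Finset.sum_add_distrib]
      refine Finset.sum_congr rfl fun i _ => ?_
      cases σ i <;> simp [signVal] <;> ring
    rw [h3]
    exact add_le_add (Finset.le_sup' (fun θ => signSum σ (lossVec ℓ (fun i => (W i).2) θ)) hθ)
      (Finset.le_sup' (fun θ => signSum (fun i => !σ i) (lossVec ℓ (fun i => (W i).1) θ)) hθ)
  have hfst : MeasurePreserving (fun (W : Fin n → 𝒵 × 𝒵) i => (W i).1) ν μ :=
    measurePreserving_pi (fun _ : Fin n => D.prod D) (fun _ : Fin n => D)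
      fun _ => measurePreserving_fst
  have hsnd : MeasurePreserving (fun (W : Fin n → 𝒵 × 𝒵) i => (W i).2) ν μ :=
    measurePreserving_pi (fun _ : Fin n => D.prod D) (fun _ : Fin n => D)
      fun _ => measurePreserving_snd
  have hf : ∀ g : (Fin n → 𝒵 × 𝒵) → Fin n → 𝒵, MeasurePreserving g ν μ →
      Integrable (fun W => radSup T hT (lossVec ℓ (g W))) ν ∧
      ∫ W, radSup T hT (lossVec ℓ (g W)) ∂ν = ∫ Z, radSup T hT (lossVec ℓ Z) ∂μ := by
    intro g hg
    refine ⟨hg.integrable_comp_of_integrable hradi, ?_⟩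
    rw [← hg.map_eq, integral_map hg.measurable.aemeasurable
      (measurable_radSup hm T hT).aestronglyMeasurable]
  rw [hB] at hA
  refine hA.trans ?_
  have hSavg : Integrable
      (fun W => signAvg (fun σ : Fin n → Bool => S (fun i => signVal (σ i)) W)) ν :=
    (integrable_finsetSum _ fun σ _ => hSi _ (hsign σ)).const_mul _
  refine (integral_mono hSavg ((hf _ hsnd).1.add (hf _ hfst).1) hC).trans_eq ?_
  rw [integral_add' (hf _ hsnd).1 (hf _ hfst).1, (hf _ hsnd).2, (hf _ hfst).2,
    integral_const_mul]
  ring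

include hm h0 h1 in
/-- Uniform deviation bound for a finite class in terms of an upper bound `r` of its empirical
Rademacher average. -/
theorem measure_exists_mem_gt_le (hn : 0 < n) (r : (Fin n → 𝒵) → ℝ)
    (hr : ∀ Z, radSup T hT (lossVec ℓ Z) ≤ r Z) {δ : ℝ} (hδ : 0 < δ) (hδ1 : δ < 1) :
    Measure.pi (fun _ : Fin n => D)
      {Z | ∃ θ ∈ T, 2 * r Z + 3 * √(n * Real.log (1 / δ)) < ∑ i, (∫ z, ℓ θ z ∂D - ℓ θ (Z i))}
      ≤ ENNReal.ofReal δ := by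
  have hn' : (0 : ℝ) < n := by exact_mod_cast hn
  have hlog : 0 < Real.log (1 / δ) := Real.log_pos (by rw [lt_div_iff₀ hδ]; linarith)
  set f : (Fin n → 𝒵) → ℝ := fun Z => maxDev D ℓ T hT Z - 2 * radSup T hT (lossVec ℓ Z) with hf
  have hdevd : ∀ (Z : Fin n → 𝒵) i z, maxDev D ℓ T hT (Function.update Z i z)
      ≤ maxDev D ℓ T hT Z + 1 := by
    intro Z i z
    refine Finset.sup'_le _ _ fun θ hθ => ?_
    refine (sum_update_le (F := fun _ z => ∫ z, ℓ θ z ∂D - ℓ θ z) (c := 1) (fun i z z' => ?_)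
      Z i z).trans (add_le_add (Finset.le_sup'
        (fun θ => ∑ i, (∫ z, ℓ θ z ∂D - ℓ θ (Z i))) hθ) le_rfl)
    linarith [(abs_le.1 (abs_loss_sub_le h0 h1 θ z z')).1]
  have hradd : ∀ (Z : Fin n → 𝒵) i z, radSup T hT (lossVec ℓ (Function.update Z i z))
      ≤ radSup T hT (lossVec ℓ Z) + 1 := by
    intro Z i z
    rw [← signAvg_const (n := n) (1 : ℝ), radSup, radSup, ← signAvg_add]
    refine signAvg_mono fun σ => Finset.sup'_le _ _ fun θ hθ => ?_
    refine (sum_update_le (F := fun i z => signVal (σ i) * ℓ θ z) (c := 1) (fun i z z' => ?_)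
      Z i z).trans (add_le_add (Finset.le_sup' (fun θ => signSum σ (lossVec ℓ Z θ)) hθ) le_rfl)
    have h := abs_loss_sub_le h0 h1 θ z z'
    have h2 : signVal (σ i) * (ℓ θ z - ℓ θ z') ≤ 1 := by
      refine (le_abs_self _).trans ?_
      rwa [abs_mul, abs_signVal, one_mul]
    linarith
  -- The constant `3` is `1` for the deviation plus `2 · 1` for twice the Rademacher average. The
  -- latter is subtracted, so its bound is used backwards, from the updated sample to the original
  -- one.
  have hdiff : ∀ Z i z, f (Function.update Z i z) ≤ f Z + 3 := by
    intro Z i z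
    have a := hdevd Z i z
    have b := hradd (Function.update Z i z) i (Z i)
    rw [Function.update_idem, Function.update_eq_self] at b
    simp only [hf]
    linarith
  have hfm : Measurable f :=
    (measurable_maxDev T hT hm).sub ((measurable_radSup hm T hT).const_mul 2)
  have hfb : ∀ Z, |f Z| ≤ n + 2 * n := fun Z => by
    refine (abs_sub _ _).trans (add_le_add (abs_maxDev_le hm h0 h1 T hT Z) ?_)
    rw [abs_mul, abs_two]
    gcongr
    exact abs_radSup_le h0 h1 T hT Z
  have hmean : ∫ Y, f Y ∂Measure.pi (fun _ : Fin n => D) ≤ 0 := by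
    have i1 : Integrable (fun Z : Fin n → 𝒵 => maxDev D ℓ T hT Z) (Measure.pi fun _ => D) :=
      integrable_of_abs_le (measurable_maxDev T hT hm) (abs_maxDev_le hm h0 h1 T hT)
    have i2 : Integrable (fun Z : Fin n → 𝒵 => radSup T hT (lossVec ℓ Z)) (Measure.pi fun _ => D) :=
      integrable_of_abs_le (measurable_radSup hm T hT) (abs_radSup_le h0 h1 T hT)
    simp only [hf]
    rw [integral_sub i1 (i2.const_mul 2), sub_nonpos]
    exact integral_maxDev_le hm h0 h1 T hT
  have hmc := measure_ge_le_of_bounded_differences (D := D) hn hfm hfb (c := 3) (by norm_num) hdiff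
    (t := 3 * √(n * Real.log (1 / δ))) (by positivity) hmean
  refine (measure_mono fun Z hZ => ?_).trans (hmc.trans (ENNReal.ofReal_le_ofReal ?_))
  · obtain ⟨θ, hθ, hlt⟩ := hZ
    have h3 : ∑ i, (∫ z, ℓ θ z ∂D - ℓ θ (Z i)) ≤ maxDev D ℓ T hT Z :=
      Finset.le_sup' (fun θ => ∑ i, (∫ z, ℓ θ z ∂D - ℓ θ (Z i))) hθ
    have h4 := hr Z
    change 3 * √(n * Real.log (1 / δ)) ≤ f Z
    simp only [hf]
    linarith
  -- McDiarmid's inequality gives `δ²` here, which is more than needed.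
  · have e : -(2 * (3 * √(n * Real.log (1 / δ))) ^ 2 / (n * 3 ^ 2)) = -(2 * Real.log (1 / δ)) := by
      rw [mul_pow, Real.sq_sqrt (by positivity)]; field_simp
    rw [e]
    calc Real.exp (-(2 * Real.log (1 / δ))) ≤ Real.exp (-Real.log (1 / δ)) := by
          gcongr; linarith
      _ = δ := by rw [one_div, Real.log_inv, neg_neg, Real.exp_log hδ]

end Symmetrization

/-! ### From entropy to a uniform bound over an infinite class -/

section UniformBound

variable {𝒵 : Type*} [MeasurableSpace 𝒵] {D : Measure 𝒵} [IsProbabilityMeasure D]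
  {Θ : Type*} {n : ℕ} {ℓ : Θ → 𝒵 → ℝ} {h : 𝒵 → ℝ} {B : ℝ}

omit [MeasurableSpace 𝒵] in
/-- The Rademacher average of a class of `[0, 1]`-valued losses whose metric entropy at scale `ε`,
relative to the envelope `h`, is at most `√(B / ε)`. -/
lemma radSup_lossVec_le (hn : 0 < n) (h0 : ∀ θ z, 0 ≤ ℓ θ z) (h1 : ∀ θ z, ℓ θ z ≤ 1)
    (hnet : ∀ ε : ℝ, 0 < ε → ∃ N : Finset Θ,
      (∀ θ, ∃ θ' ∈ N, ∀ z, |ℓ θ z - ℓ θ' z| ≤ ε * h z) ∧ Real.log N.card ≤ √(B / ε))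
    (T : Finset Θ) (hT : T.Nonempty) (Z : Fin n → 𝒵) :
    radSup T hT (lossVec ℓ Z) ≤ 5 * √n * √(√(B * √(∑ i, h (Z i) ^ 2) / √n)) := by
  have hn' : (0 : ℝ) < n := by exact_mod_cast hn
  set H := √(∑ i, h (Z i) ^ 2) with hH
  have hdist : ∀ (θ θ' : Θ) (e : ℝ) (g : 𝒵 → ℝ), 0 ≤ e → (∀ z, |ℓ θ z - ℓ θ' z| ≤ e * g z) →
      ‖lossVec ℓ Z θ - lossVec ℓ Z θ'‖ ≤ e * √(∑ i, g (Z i) ^ 2) := by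
    intro θ θ' e g he hle
    rw [EuclideanSpace.norm_eq]
    refine Real.sqrt_le_iff.2 ⟨by positivity, ?_⟩
    rw [mul_pow, Real.sq_sqrt (Finset.sum_nonneg fun i _ => sq_nonneg _), Finset.mul_sum]
    refine Finset.sum_le_sum fun i _ => ?_
    rw [← mul_pow]
    exact pow_le_pow_left₀ (norm_nonneg _) (hle (Z i)) 2
  refine radSup_le_of_entropy T hT _ (Real.sqrt_pos.2 hn') (fun θ θ' => ?_) fun ε hε => ?_
  · have := hdist θ θ' 1 (fun _ => 1) zero_le_one fun z => by
      rw [mul_one]; exact abs_le.2 ⟨by linarith [h0 θ z, h1 θ' z], by linarith [h0 θ' z, h1 θ z]⟩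
    simpa using this
  · rcases (Real.sqrt_nonneg (∑ i, h (Z i) ^ 2)).eq_or_lt with hz | hpos
    -- The envelope vanishes on the sample, so the sample cannot set the scale. At scale `4|B| + 1`
    -- the entropy is at most `1/2 < log 2`, so the net has at most one point and all loss vectors
    -- coincide.
    · obtain ⟨N, hN, hlog⟩ := hnet (4 * |B| + 1) (by positivity)
      have hzero : ∀ i, h (Z i) = 0 := by
        have h2 : ∑ i, h (Z i) ^ 2 = 0 :=
          (Real.sqrt_eq_zero (Finset.sum_nonneg fun i _ => sq_nonneg _)).1 hz.symm
        intro i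
        have := (Finset.sum_eq_zero_iff_of_nonneg fun i _ => sq_nonneg (h (Z i))).1 h2 i
          (Finset.mem_univ i)
        simpa using this
      have hcard : N.card ≤ 1 := by
        by_contra! hlt
        have h2 : (2 : ℝ) ≤ N.card := by exact_mod_cast hlt
        have h3 := (Real.log_le_log two_pos h2).trans hlog
        have h4 : √(B / (4 * |B| + 1)) ≤ 1 / 2 := by
          refine Real.sqrt_le_iff.2 ⟨by norm_num, ?_⟩
          rw [div_le_iff₀ (by positivity)]
          linarith [le_abs_self B]
        linarith [Real.log_two_gt_d9]
      refine ⟨N, fun θ => ?_, ?_⟩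
      · obtain ⟨θ', hθ', hle⟩ := hN θ
        refine ⟨θ', hθ', ?_⟩
        have hsame : lossVec ℓ Z θ = lossVec ℓ Z θ' := by
          ext i
          have := hle (Z i)
          rw [hzero, mul_zero] at this
          exact sub_eq_zero.1 (abs_eq_zero.1 (le_antisymm this (abs_nonneg _)))
        rw [hsame, sub_self, norm_zero]
        exact hε.le
      · refine le_trans ?_ (Real.sqrt_nonneg _)
        exact Real.log_nonpos (Nat.cast_nonneg _) (by exact_mod_cast hcard)
    · obtain ⟨N, hN, hlog⟩ := hnet (ε / H) (by positivity)
      refine ⟨N, fun θ => ?_, ?_⟩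
      · obtain ⟨θ', hθ', hle⟩ := hN θ
        refine ⟨θ', hθ', (hdist θ θ' (ε / H) h (by positivity) hle).trans_eq ?_⟩
        exact div_mul_cancel₀ _ hpos.ne'
      · refine hlog.trans_eq ?_
        congr 1
        field_simp

/-- Uniform deviation bound for a class of `[0, 1]`-valued losses whose metric entropy at scale `ε`,
relative to the envelope `h`, is at most `√(B / ε)`. -/
theorem measure_exists_gt_le [Nonempty Θ] (hn : 0 < n) (hm : ∀ θ, Measurable (ℓ θ))
    (h0 : ∀ θ z, 0 ≤ ℓ θ z) (h1 : ∀ θ z, ℓ θ z ≤ 1)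
    (hnet : ∀ ε : ℝ, 0 < ε → ∃ N : Finset Θ,
      (∀ θ, ∃ θ' ∈ N, ∀ z, |ℓ θ z - ℓ θ' z| ≤ ε * h z) ∧ Real.log N.card ≤ √(B / ε))
    {δ : ℝ} (hδ : 0 < δ) (hδ1 : δ < 1) :
    Measure.pi (fun _ : Fin n => D)
      {Z | ∃ θ, 2 * (5 * √n * √(√(B * √(∑ i, h (Z i) ^ 2) / √n))) + 3 * √(n * Real.log (1 / δ))
        < ∑ i, (∫ z, ℓ θ z ∂D - ℓ θ (Z i))}
      ≤ ENNReal.ofReal δ := by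
  classical
  set b : (Fin n → 𝒵) → ℝ := fun Z =>
    2 * (5 * √n * √(√(B * √(∑ i, h (Z i) ^ 2) / √n))) + 3 * √(n * Real.log (1 / δ)) with hb
  have hex : ∀ m : ℕ, ∃ N : Finset Θ,
      ∀ θ, ∃ θ' ∈ N, ∀ z, |ℓ θ z - ℓ θ' z| ≤ 1 / ((m : ℝ) + 1) * h z := fun m => by
    obtain ⟨N, hN, -⟩ := hnet (1 / ((m : ℝ) + 1)) (by positivity)
    exact ⟨N, hN⟩
  choose N hN using hex
  obtain ⟨θ₀⟩ := ‹Nonempty Θ›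
  -- Unions of the nets so far, so that the bad events increase with `m`.
  let T : ℕ → Finset Θ := fun m => (Finset.range (m + 1)).biUnion N
  have hTne : ∀ m, (T m).Nonempty := fun m => by
    obtain ⟨θ', hθ', -⟩ := hN m θ₀
    exact ⟨θ', Finset.mem_biUnion.2 ⟨m, Finset.mem_range.2 (Nat.lt_succ_self m), hθ'⟩⟩
  let bad : ℕ → Set (Fin n → 𝒵) := fun m =>
    {Z | ∃ θ ∈ T m, b Z < ∑ i, (∫ z, ℓ θ z ∂D - ℓ θ (Z i))}
  have hmono : Monotone bad := by
    rintro m m' hmm Z ⟨θ, hθ, hlt⟩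
    exact ⟨θ, Finset.biUnion_subset_biUnion_of_subset_left _
      (Finset.range_mono (Nat.succ_le_succ hmm)) hθ, hlt⟩
  -- Net points converge to `θ` pointwise, and dominated convergence carries the means along. The
  -- strict inequality then already holds for some net point.
  have hsub : {Z | ∃ θ, b Z < ∑ i, (∫ z, ℓ θ z ∂D - ℓ θ (Z i))} ⊆ ⋃ m, bad m := by
    rintro Z ⟨θ, hlt⟩
    choose q hqN hq using fun m => hN m θ
    have hlim : ∀ z, Filter.Tendsto (fun m => ℓ (q m) z) Filter.atTop (nhds (ℓ θ z)) := by
      intro z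
      have hz : Filter.Tendsto (fun m : ℕ => 1 / ((m : ℝ) + 1) * h z) Filter.atTop (nhds 0) := by
        simpa using tendsto_one_div_add_atTop_nhds_zero_nat.mul_const (h z)
      rw [tendsto_iff_dist_tendsto_zero]
      refine squeeze_zero (fun _ => dist_nonneg) (fun m => ?_) hz
      rw [dist_comm]
      exact hq m z
    have hint : Filter.Tendsto (fun m => ∫ z, ℓ (q m) z ∂D) Filter.atTop (nhds (∫ z, ℓ θ z ∂D)) := by
      refine tendsto_integral_of_dominated_convergence (fun _ => 1)
        (fun m => (hm _).aestronglyMeasurable) (integrable_const _)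
        (fun m => Filter.Eventually.of_forall fun z => ?_)
        (Filter.Eventually.of_forall hlim)
      rw [Real.norm_of_nonneg (h0 _ _)]
      exact h1 _ _
    have hsum : Filter.Tendsto (fun m => ∑ i, (∫ z, ℓ (q m) z ∂D - ℓ (q m) (Z i))) Filter.atTop
        (nhds (∑ i, (∫ z, ℓ θ z ∂D - ℓ θ (Z i)))) :=
      tendsto_finsetSum _ fun i _ => hint.sub (hlim (Z i))
    obtain ⟨m, hm'⟩ := (hsum.eventually_const_lt hlt).exists
    exact Set.mem_iUnion.2 ⟨m, q m, Finset.mem_biUnion.2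
      ⟨m, Finset.mem_range.2 (Nat.lt_succ_self m), hqN m⟩, hm'⟩
  refine (measure_mono hsub).trans ?_
  -- Continuity from below for increasing sets, which needs no measurability of the bad events.
  rw [hmono.measure_iUnion]
  exact iSup_le fun m => measure_exists_mem_gt_le hm h0 h1 (T m) (hTne m) hn _
    (fun Z => radSup_lossVec_le hn h0 h1 hnet (T m) (hTne m) Z) hδ hδ1

end UniformBound

/-! ### Volume bounds for nets -/

section Entropy

variable {E : Type*} [NormedAddCommGroup E] [NormedSpace ℝ E] [FiniteDimensional ℝ E]

open Module in
/-- Volume bound for the size of a separated set in a ball. -/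
lemma card_le_of_separated (s : Finset E) {a ε : ℝ} (ha : 0 ≤ a) (hε : 0 < ε)
    (hs : ∀ x ∈ s, ‖x‖ ≤ a) (h : ∀ x ∈ s, ∀ y ∈ s, x ≠ y → ε < ‖x - y‖) :
    (s.card : ℝ) ≤ (1 + 2 * (a / ε)) ^ finrank ℝ E := by
  borelize E
  let μ : Measure E := Measure.addHaar
  set r := ε / 2 with hr
  have hr0 : 0 < r := by positivity
  have hR0 : 0 < a + r := by positivity
  have hdisj : Set.Pairwise (s : Set E) (Function.onFun Disjoint fun c => Metric.ball (c : E) r) := by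
    rintro x hx y hy hxy
    apply Metric.ball_disjoint_ball
    rw [dist_eq_norm, hr]
    linarith [h x hx y hy hxy]
  have hsub : (⋃ c ∈ s, Metric.ball (c : E) r) ⊆ Metric.ball (0 : E) (a + r) := by
    refine Set.iUnion₂_subset fun x hx => Metric.ball_subset_ball' ?_
    rw [dist_zero_right]
    linarith [hs x hx]
  have hvol : (s.card : ENNReal) * ENNReal.ofReal (r ^ finrank ℝ E) * μ (Metric.ball 0 1)
      ≤ ENNReal.ofReal ((a + r) ^ finrank ℝ E) * μ (Metric.ball 0 1) :=
    calc (s.card : ENNReal) * ENNReal.ofReal (r ^ finrank ℝ E) * μ (Metric.ball 0 1)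
        = μ (⋃ c ∈ s, Metric.ball (c : E) r) := by
          rw [measure_biUnion_finset hdisj fun c _ => measurableSet_ball]
          simp only [μ.addHaar_ball_of_pos _ hr0]
          simp only [Finset.sum_const, nsmul_eq_mul, mul_assoc]
      _ ≤ μ (Metric.ball (0 : E) (a + r)) := measure_mono hsub
      _ = _ := by rw [μ.addHaar_ball_of_pos _ hR0]
  have hcard : (s.card : ENNReal) * ENNReal.ofReal (r ^ finrank ℝ E)
      ≤ ENNReal.ofReal ((a + r) ^ finrank ℝ E) :=
    (ENNReal.mul_le_mul_iff_left (Metric.measure_ball_pos _ _ zero_lt_one).ne'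
      measure_ball_lt_top.ne).1 hvol
  have hreal := ENNReal.toReal_le_of_le_ofReal (pow_nonneg hR0.le _) hcard
  rw [ENNReal.toReal_mul, ENNReal.toReal_natCast, ENNReal.toReal_ofReal (by positivity)] at hreal
  have e : 1 + 2 * (a / ε) = (a + r) / r := by rw [hr]; field_simp; ring
  rw [e, div_pow, le_div_iff₀ (by positivity)]
  exact hreal

open Module in
/-- A nonempty subset of a ball has a finite net whose size obeys the volume bound. -/
lemma exists_net (K : Set E) (hK : K.Nonempty) {a ε : ℝ} (ha : 0 ≤ a) (hε : 0 < ε)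
    (hKa : ∀ x ∈ K, ‖x‖ ≤ a) :
    ∃ N : Finset E, N.Nonempty ∧ (∀ x ∈ N, x ∈ K) ∧ (∀ x ∈ K, ∃ y ∈ N, ‖x - y‖ ≤ ε) ∧
      (N.card : ℝ) ≤ (1 + 2 * (a / ε)) ^ finrank ℝ E := by
  classical
  let good : ℕ → Prop := fun m => ∃ s : Finset E, s.card = m ∧ (∀ x ∈ s, x ∈ K) ∧
    ∀ x ∈ s, ∀ y ∈ s, x ≠ y → ε < ‖x - y‖
  have hbound : ∀ m, good m → m ≤ ⌊(1 + 2 * (a / ε)) ^ finrank ℝ E⌋₊ := by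
    rintro m ⟨s, rfl, hsK, hs⟩
    exact Nat.le_floor (card_le_of_separated s ha hε (fun x hx => hKa x (hsK x hx)) hs)
  have h0 : good 0 := ⟨∅, by simp⟩
  -- A separated subset of `K` of largest size, which exists by the volume bound, is a net by
  -- maximality. It lies inside `K`, so that net points remain admissible weights later.
  set M := Nat.findGreatest good ⌊(1 + 2 * (a / ε)) ^ finrank ℝ E⌋₊ with hM
  have hgood : good M := Nat.findGreatest_spec (Nat.zero_le _) h0
  obtain ⟨s, hcard, hsK, hs⟩ := hgood
  have hcov : ∀ x ∈ K, ∃ y ∈ s, ‖x - y‖ ≤ ε := by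
    intro x hx
    by_contra! hfar
    have hxs : x ∉ s := fun hxs => by
      have := hfar x hxs
      rw [sub_self, norm_zero] at this
      linarith
    have hg : good (M + 1) := by
      refine ⟨insert x s, by rw [Finset.card_insert_of_notMem hxs, hcard], ?_, ?_⟩
      · intro y hy
        rcases Finset.mem_insert.1 hy with rfl | hy
        · exact hx
        · exact hsK y hy
      · intro y hy z hz hyz
        rcases Finset.mem_insert.1 hy with rfl | hy' <;> rcases Finset.mem_insert.1 hz with rfl | hz'
        · exact absurd rfl hyz
        · exact hfar z hz'
        · rw [norm_sub_rev]; exact hfar y hy'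
        · exact hs y hy' z hz' hyz
    have := Nat.le_findGreatest (hbound _ hg) hg
    omega
  refine ⟨s, ?_, hsK, hcov, card_le_of_separated s ha hε (fun x hx => hKa x (hsK x hx)) hs⟩
  obtain ⟨x, hx⟩ := hK
  obtain ⟨y, hy, -⟩ := hcov x hx
  exact ⟨y, hy⟩

/-- A power bound in place of the sharper logarithm: it gives the entropy the form `√(B/ε)`, which
is stable under summation over the layers. -/
lemma log_one_add_two_mul_le {x : ℝ} (hx : 0 ≤ x) : Real.log (1 + 2 * x) ≤ √(8 * x) := by
  have h1 : 1 + 2 * x ≤ (1 + √(2 * x)) ^ 2 := by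
    have := Real.sq_sqrt (show 0 ≤ 2 * x by positivity)
    nlinarith [Real.sqrt_nonneg (2 * x)]
  have h2 : √(8 * x) = 2 * √(2 * x) := by
    rw [show 8 * x = 2 ^ 2 * (2 * x) by ring, Real.sqrt_mul (by norm_num),
      Real.sqrt_sq (by norm_num)]
  calc Real.log (1 + 2 * x) ≤ Real.log ((1 + √(2 * x)) ^ 2) :=
        Real.log_le_log (by positivity) h1
    _ = 2 * Real.log (1 + √(2 * x)) := by rw [Real.log_pow]; norm_num
    _ ≤ 2 * √(2 * x) := by
        have := Real.log_le_sub_one_of_pos (show 0 < 1 + √(2 * x) by positivity)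
        linarith
    _ = _ := h2.symm

open Module in
/-- Entropy bound for a subset of a ball, with respect to `κ` times the norm. -/
lemma exists_net_log_le (K : Set E) (hK : K.Nonempty) {a κ ε : ℝ} (hκ : 0 ≤ κ) (hε : 0 < ε)
    (hKa : ∀ x ∈ K, ‖x‖ ≤ a) :
    ∃ N : Finset E, (∀ x ∈ N, x ∈ K) ∧ (∀ x ∈ K, ∃ y ∈ N, κ * ‖x - y‖ ≤ ε) ∧
      Real.log N.card ≤ √(8 * ((finrank ℝ E : ℝ) ^ 2 * a * κ / ε)) := by
  obtain ⟨x₀, hx₀⟩ := hK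
  have ha : 0 ≤ a := (norm_nonneg _).trans (hKa x₀ hx₀)
  rcases hκ.eq_or_lt with rfl | hκ
  · exact ⟨{x₀}, by simpa using hx₀, fun x _ => ⟨x₀, by simp, by simpa using hε.le⟩, by simp⟩
  · obtain ⟨N, hne, hNK, hcov, hcard⟩ := exists_net K ⟨x₀, hx₀⟩ ha (show 0 < ε / κ by positivity) hKa
    refine ⟨N, hNK, fun x hx => ?_, ?_⟩
    · obtain ⟨y, hy, hxy⟩ := hcov x hx
      refine ⟨y, hy, ?_⟩
      rw [le_div_iff₀ hκ] at hxy
      linarith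
    · have hc : (0 : ℝ) < N.card := by exact_mod_cast hne.card_pos
      calc Real.log N.card ≤ Real.log ((1 + 2 * (a / (ε / κ))) ^ finrank ℝ E) :=
            Real.log_le_log hc hcard
        _ = finrank ℝ E * Real.log (1 + 2 * (a / (ε / κ))) := Real.log_pow _ _
        _ ≤ finrank ℝ E * √(8 * (a / (ε / κ))) := by
            gcongr
            exact log_one_add_two_mul_le (by positivity)
        _ = √((finrank ℝ E : ℝ) ^ 2 * (8 * (a / (ε / κ)))) := by
            rw [Real.sqrt_mul (sq_nonneg _), Real.sqrt_sq (Nat.cast_nonneg _)]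
        _ = _ := by
            congr 1
            field_simp

end Entropy

/-! ### Spectral and Frobenius norms, unrolled convolutions -/

section MatrixNorms

variable {m n : ℕ}

open scoped Matrix.Norms.Frobenius in
lemma frobNorm_sq (M : Matrix (Fin m) (Fin n) ℝ) : frobNorm M ^ 2 = ∑ i, ∑ j, M i j ^ 2 := by
  rw [frobNorm, Matrix.frobenius_norm_def, ← Real.sqrt_eq_rpow, Real.sq_sqrt (by positivity)]
  simp

open scoped Matrix.Norms.Frobenius in
lemma frobNorm_nonneg (M : Matrix (Fin m) (Fin n) ℝ) : 0 ≤ frobNorm M := norm_nonneg M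

open scoped Matrix.Norms.L2Operator in
lemma specNorm_nonneg (M : Matrix (Fin m) (Fin n) ℝ) : 0 ≤ specNorm M := norm_nonneg M

open scoped Matrix.Norms.L2Operator in
lemma norm_mulVec_le (M : Matrix (Fin m) (Fin n) ℝ) (x : Vec n) :
    ‖(WithLp.toLp 2 (M.mulVec (WithLp.ofLp x)) : Vec m)‖ ≤ specNorm M * ‖x‖ :=
  Matrix.l2_opNorm_mulVec M x

open scoped Matrix.Norms.L2Operator in
lemma specNorm_le_frobNorm (M : Matrix (Fin m) (Fin n) ℝ) : specNorm M ≤ frobNorm M := by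
  rw [specNorm, Matrix.l2_opNorm_def]
  refine ContinuousLinearMap.opNorm_le_bound _ (frobNorm_nonneg M) fun x => ?_
  change ‖(WithLp.toLp 2 (M.mulVec (WithLp.ofLp x)) : Vec m)‖ ≤ _
  refine le_of_sq_le_sq ?_ (mul_nonneg (frobNorm_nonneg M) (norm_nonneg x))
  rw [mul_pow, frobNorm_sq, EuclideanSpace.real_norm_sq_eq, EuclideanSpace.real_norm_sq_eq,
    Finset.sum_mul]
  exact Finset.sum_le_sum fun i _ =>
    Finset.sum_mul_sq_le_sq_mul_sq Finset.univ (fun j => M i j) fun j => x j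

lemma sum_sq_sum_ite_embedding {r d : ℕ} (S : Fin r ↪ Fin d) (u : Fin r → ℝ) :
    ∑ p, (∑ t, if S t = p then u t else 0) ^ 2 = ∑ t, u t ^ 2 := by
  have h : ∀ p, (∑ t, if S t = p then u t else 0) ^ 2 = ∑ t, if S t = p then u t ^ 2 else 0 := by
    intro p
    by_cases hp : ∃ t₀, S t₀ = p
    · obtain ⟨t₀, rfl⟩ := hp
      simp [S.injective.eq_iff]
    · push Not at hp
      simp [hp]
  simp only [h]
  rw [Finset.sum_comm]
  simp

/-- Each filter occurs in `m = dOut / c` rows, and placing its entries at distinct positions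
preserves their sum of squares. For `c = 0` the quotient is the default `0`, and both norms vanish.
-/
lemma frobNorm_gamma_le {dIn dOut : ℕ} (P : ConvPattern dIn dOut)
    (W : Matrix (Fin P.c) (Fin P.r) ℝ) :
    frobNorm (P.gamma W) ≤ √((dOut : ℝ) / P.c) * frobNorm W := by
  refine le_of_sq_le_sq ?_ (mul_nonneg (Real.sqrt_nonneg _) (frobNorm_nonneg W))
  have hg : frobNorm (P.gamma W) ^ 2 = P.m * frobNorm W ^ 2 := by
    rw [frobNorm_sq, frobNorm_sq]
    let e : Fin dOut ≃ Fin P.c × Fin P.m := (finCongr P.out_eq).trans finProdFinEquiv.symm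
    have h1 : ∀ o, ∑ p, P.gamma W o p ^ 2 = (fun q : Fin P.c × Fin P.m => ∑ t, W q.1 t ^ 2) (e o) :=
      fun o => sum_sq_sum_ite_embedding (P.S (e o).1 (e o).2) (W (e o).1)
    simp only [h1]
    rw [Equiv.sum_comp e (fun q : Fin P.c × Fin P.m => ∑ t, W q.1 t ^ 2), Fintype.sum_prod_type]
    simp [Finset.mul_sum]
  rw [mul_pow, Real.sq_sqrt (by positivity), hg]
  rcases Nat.eq_zero_or_pos P.c with hc | hc
  · have : frobNorm W ^ 2 = 0 := by
      rw [frobNorm_sq]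
      have : IsEmpty (Fin P.c) := by rw [hc]; infer_instance
      simp
    rw [this]; simp
  · have hc' : (P.c : ℝ) ≠ 0 := by exact_mod_cast hc.ne'
    have hd : (dOut : ℝ) = P.c * P.m := by exact_mod_cast P.out_eq
    have : (dOut : ℝ) / P.c = P.m := by rw [hd]; field_simp
    rw [this]

lemma gamma_sub {dIn dOut : ℕ} (P : ConvPattern dIn dOut) (W W' : Matrix (Fin P.c) (Fin P.r) ℝ) :
    P.gamma W - P.gamma W' = P.gamma (W - W') := by
  ext o p
  simp only [ConvPattern.gamma, Matrix.sub_apply, Matrix.of_apply, ← Finset.sum_sub_distrib]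
  refine Finset.sum_congr rfl fun t _ => ?_
  split_ifs <;> simp

end MatrixNorms

/-! ### Entropy of a single layer -/

section LayerEntropy

open scoped Matrix.Norms.Frobenius in
lemma exists_matrix_net {m n : ℕ} (K : Set (Matrix (Fin m) (Fin n) ℝ)) (hK : K.Nonempty)
    {a κ ε : ℝ} (hκ : 0 ≤ κ) (hε : 0 < ε) (hKa : ∀ M ∈ K, frobNorm M ≤ a) :
    ∃ N : Finset (Matrix (Fin m) (Fin n) ℝ), (∀ M ∈ N, M ∈ K) ∧
      (∀ M ∈ K, ∃ M' ∈ N, κ * frobNorm (M - M') ≤ ε) ∧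
      Real.log N.card ≤ √(8 * ((m : ℝ) ^ 2 * (n : ℝ) ^ 2 * a * κ / ε)) := by
  obtain ⟨N, h1, h2, h3⟩ := exists_net_log_le K hK hκ hε hKa
  refine ⟨N, h1, h2, h3.trans_eq ?_⟩
  have : Module.finrank ℝ (Matrix (Fin m) (Fin n) ℝ) = m * n := by
    rw [Module.finrank_matrix]; simp
  rw [this]; push_cast; rw [mul_pow]

lemma Layer.term_nonneg {dIn dOut : ℕ} (l : Layer dIn dOut) {a s : ℝ} (ha : 0 ≤ a) (hs : 0 ≤ s) :
    0 ≤ l.term a s := by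
  cases l <;> simp only [Layer.term] <;> positivity

lemma Layer.weightNorm_nonneg {dIn dOut : ℕ} (l : Layer dIn dOut) (w : l.Weight) :
    0 ≤ l.weightNorm w := by
  cases l
  · exact frobNorm_nonneg (m := dOut) (n := dIn) w
  · rename_i P
    exact frobNorm_nonneg (m := P.c) (n := P.r) w

/-- Entropy bound for the admissible weights of one layer. -/
lemma Layer.exists_net {dIn dOut : ℕ} (l : Layer dIn dOut) {a s τ : ℝ} (hs : 0 < s) (hτ : 0 < τ)
    (hne : ∃ w, l.weightNorm w ≤ a ∧ specNorm (l.matrix w) ≤ s) :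
    ∃ N : Finset l.Weight, (∀ w ∈ N, l.weightNorm w ≤ a ∧ specNorm (l.matrix w) ≤ s) ∧
      (∀ w, l.weightNorm w ≤ a ∧ specNorm (l.matrix w) ≤ s →
        ∃ w' ∈ N, specNorm (l.matrix w - l.matrix w') ≤ s * τ) ∧
      Real.log N.card ≤ √(8 * (l.term a s / τ)) := by
  -- The radius is taken relative to `s`, which produces the division by `s` in the layer's term.
  -- The Frobenius distance of the weights is multiplied by `1` for a dense layer and by `√(dOut /
  -- c)` for a convolution.
  have hsτ : 0 < s * τ := mul_pos hs hτ
  cases l with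
  | dense =>
    obtain ⟨N, h1, h2, h3⟩ := exists_matrix_net
      {A : Matrix (Fin dOut) (Fin dIn) ℝ | frobNorm A ≤ a ∧ specNorm A ≤ s} hne
      zero_le_one hsτ fun A hA => hA.1
    refine ⟨N, h1, fun A hA => ?_, h3.trans_eq ?_⟩
    · obtain ⟨A', hA', hle⟩ := h2 A hA
      refine ⟨A', hA', (specNorm_le_frobNorm _).trans ?_⟩
      rwa [one_mul] at hle
    · simp only [Layer.term]
      congr 2
      field_simp
  | conv P =>
    obtain ⟨N, h1, h2, h3⟩ := exists_matrix_net
      {W : Matrix (Fin P.c) (Fin P.r) ℝ | frobNorm W ≤ a ∧ specNorm (P.gamma W) ≤ s} hne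
      (Real.sqrt_nonneg ((dOut : ℝ) / P.c)) hsτ fun A hA => hA.1
    refine ⟨N, h1, fun W hW => ?_, h3.trans_eq ?_⟩
    · obtain ⟨W', hW', hle⟩ := h2 W hW
      refine ⟨W', hW', ?_⟩
      exact (congrArg specNorm (gamma_sub P W W')).trans_le
        ((specNorm_le_frobNorm _).trans ((frobNorm_gamma_le P _).trans hle))
    · simp only [Layer.term]
      congr 2
      rw [div_div]

end LayerEntropy

/-! ### Perturbation and entropy of the whole network -/

namespace CNN

variable {L : ℕ} (N : CNN L)

lemma layerOutput_zero (w : N.Weights) (x : Vec N.inDim) : N.layerOutput w x 0 = x := rfl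

lemma layerOutput_succ (w : N.Weights) (x : Vec N.inDim) (i : Fin L) :
    N.layerOutput w x i.succ = N.act i (WithLp.toLp 2
      (((N.layer i).matrix (w i)).mulVec (WithLp.ofLp (N.layerOutput w x i.castSucc)))) := rfl

/-- The product of the Lipschitz constants of the first `i` layers. -/
noncomputable def lipProd (ρ : Fin L → ℝ≥0) (s : Fin L → ℝ) (i : Fin (L + 1)) : ℝ :=
  ∏ j with j.castSucc < i, (ρ j : ℝ) * s j

lemma lipProd_zero (ρ : Fin L → ℝ≥0) (s : Fin L → ℝ) : lipProd ρ s 0 = 1 := by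
  simp [lipProd]

lemma lipProd_succ (ρ : Fin L → ℝ≥0) (s : Fin L → ℝ) (i : Fin L) :
    lipProd ρ s i.succ = ρ i * s i * lipProd ρ s i.castSucc := by
  have : (Finset.univ.filter fun j : Fin L => j.castSucc < i.succ)
      = insert i (Finset.univ.filter fun j : Fin L => j.castSucc < i.castSucc) := by
    ext j
    simp only [Finset.mem_filter, Finset.mem_univ, true_and, Finset.mem_insert, Fin.lt_def,
      Fin.val_castSucc, Fin.val_succ, Fin.ext_iff]
    omega
  rw [lipProd, this, Finset.prod_insert (by simp)]
  rfl

lemma lipProd_last (ρ : Fin L → ℝ≥0) (s : Fin L → ℝ) :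
    lipProd ρ s (Fin.last L) = ∏ j, (ρ j : ℝ) * s j := by
  simp [lipProd, Fin.castSucc_lt_last]

variable {N} {ρ : Fin L → ℝ≥0} (hLip : ∀ i, LipschitzWith (ρ i) (N.act i))
  {a s : Fin L → ℝ} (hs : ∀ i, 0 < s i)

include hLip hs in
lemma norm_layerOutput_le (hzero : ∀ i, N.act i 0 = 0) {w : N.Weights} (hw : N.Admissible a s w)
    (x : Vec N.inDim) (i : Fin (L + 1)) : ‖N.layerOutput w x i‖ ≤ lipProd ρ s i * ‖x‖ := by
  induction i using Fin.induction with
  | zero => rw [layerOutput_zero, lipProd_zero, one_mul]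
  | succ i ih =>
    rw [layerOutput_succ, lipProd_succ]
    have h := (hLip i).dist_le_mul (WithLp.toLp 2
      (((N.layer i).matrix (w i)).mulVec (WithLp.ofLp (N.layerOutput w x i.castSucc)))) 0
    rw [hzero, dist_zero_right, dist_zero_right] at h
    calc _ ≤ _ := h
      _ ≤ ρ i * (s i * (lipProd ρ s i.castSucc * ‖x‖)) := by
        refine mul_le_mul_of_nonneg_left ((norm_mulVec_le _ _).trans ?_) (ρ i).coe_nonneg
        exact mul_le_mul (hw i).2 ih (norm_nonneg _) (hs i).le
      _ = _ := by ring

-- Relative errors add up: writing `Mz - M'z' = M(z - z') + (M - M')z'`, the first term passes on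
-- the accumulated error and the second adds one more `τ`, since `z'` obeys the norm bound of
-- `norm_layerOutput_le`.
include hLip hs in
lemma norm_layerOutput_sub_le (hzero : ∀ i, N.act i 0 = 0) {w w' : N.Weights}
    (hw : N.Admissible a s w) (hw' : N.Admissible a s w') {τ : ℝ}
    (hd : ∀ i, specNorm ((N.layer i).matrix (w i) - (N.layer i).matrix (w' i)) ≤ s i * τ)
    (x : Vec N.inDim) (i : Fin (L + 1)) :
    ‖N.layerOutput w x i - N.layerOutput w' x i‖ ≤ lipProd ρ s i * (i : ℕ) * τ * ‖x‖ := by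
  induction i using Fin.induction with
  | zero => simp [layerOutput_zero]
  | succ i ih =>
    rw [layerOutput_succ, layerOutput_succ, lipProd_succ, ← dist_eq_norm]
    set z := N.layerOutput w x i.castSucc
    set z' := N.layerOutput w' x i.castSucc with hz'
    set M := (N.layer i).matrix (w i)
    set M' := (N.layer i).matrix (w' i)
    have hzn : ‖z'‖ ≤ lipProd ρ s i.castSucc * ‖x‖ :=
      norm_layerOutput_le hLip hs hzero hw' x i.castSucc
    refine ((hLip i).dist_le_mul _ _).trans ?_
    have he : (WithLp.toLp 2 (M.mulVec (WithLp.ofLp z)) : Vec (N.width i.succ))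
        - WithLp.toLp 2 (M'.mulVec (WithLp.ofLp z'))
        = WithLp.toLp 2 (M.mulVec (WithLp.ofLp (z - z')))
          + WithLp.toLp 2 ((M - M').mulVec (WithLp.ofLp z')) := by
      rw [← WithLp.toLp_sub, ← WithLp.toLp_add, WithLp.ofLp_sub, Matrix.mulVec_sub,
        Matrix.sub_mulVec]
      congr 1
      abel
    have hsum : dist (WithLp.toLp 2 (M.mulVec (WithLp.ofLp z)) : Vec (N.width i.succ))
        (WithLp.toLp 2 (M'.mulVec (WithLp.ofLp z')))
        ≤ s i * (lipProd ρ s i.castSucc * (i : ℕ) * τ * ‖x‖)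
          + s i * τ * (lipProd ρ s i.castSucc * ‖x‖) := by
      rw [dist_eq_norm, he]
      refine (norm_add_le _ _).trans (add_le_add ((norm_mulVec_le _ _).trans ?_)
        ((norm_mulVec_le _ _).trans ?_))
      · exact mul_le_mul (hw i).2 ih (norm_nonneg _) (hs i).le
      · exact mul_le_mul (hd i) hzn (norm_nonneg _) ((specNorm_nonneg _).trans (hd i))
    refine (mul_le_mul_of_nonneg_left hsum (ρ i).coe_nonneg).trans_eq ?_
    rw [Fin.val_succ]
    push_cast
    ring

include hLip in
lemma continuous_eval (w : N.Weights) : Continuous (N.eval w) := by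
  have h : ∀ i, Continuous fun x => N.layerOutput w x i := by
    intro i
    induction i using Fin.induction with
    | zero => exact continuous_id
    | succ i ih =>
      simp only [layerOutput_succ]
      refine (hLip i).continuous.comp ((PiLp.continuous_toLp 2 _).comp ?_)
      exact Continuous.matrix_mulVec continuous_const ((PiLp.continuous_ofLp 2 _).comp ih)
  exact h (Fin.last L)

include hs in
/-- Entropy bound for the admissible weights of a network. -/
lemma exists_net {τ : ℝ} (hτ : 0 < τ) {w₀ : N.Weights} (hw₀ : N.Admissible a s w₀) :
    ∃ T : Finset N.Weights, (∀ w ∈ T, N.Admissible a s w) ∧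
      (∀ w, N.Admissible a s w → ∃ w' ∈ T,
        ∀ i, specNorm ((N.layer i).matrix (w i) - (N.layer i).matrix (w' i)) ≤ s i * τ) ∧
      Real.log T.card ≤ √(8 * (L * (∑ i, (N.layer i).term (a i) (s i)) / τ)) := by
  have hex := fun i => (N.layer i).exists_net (hs i) hτ ⟨w₀ i, hw₀ i⟩
  choose T hT hcov hlog using hex
  refine ⟨Fintype.piFinset T, fun w hw i => hT i _ (Fintype.mem_piFinset.1 hw i), fun w hw => ?_, ?_⟩
  · choose w' hw' hd using fun i => hcov i (w i) (hw i)
    exact ⟨w', Fintype.mem_piFinset.2 hw', hd⟩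
  · have hpos : ∀ i, ((T i).card : ℝ) ≠ 0 := fun i => by
      obtain ⟨w', hw', -⟩ := hcov i (w₀ i) (hw₀ i)
      exact_mod_cast (Finset.card_pos.2 ⟨w', hw'⟩).ne'
    have ht : ∀ i, 0 ≤ (N.layer i).term (a i) (s i) := fun i =>
      (N.layer i).term_nonneg (((N.layer i).weightNorm_nonneg _).trans (hw₀ i).1) (hs i).le
    rw [Fintype.card_piFinset]
    push_cast
    rw [Real.log_prod fun i _ => hpos i]
    -- Cauchy-Schwarz turns the sum of `L` roots into one root, at the cost of a factor `L` inside.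
    refine (Finset.sum_le_sum fun i _ => hlog i).trans (Real.le_sqrt_of_sq_le ?_)
    refine sq_sum_le_card_mul_sum_sq.trans_eq ?_
    have : ∀ i, √(8 * ((N.layer i).term (a i) (s i) / τ)) ^ 2
        = 8 * ((N.layer i).term (a i) (s i) / τ) := fun i =>
      Real.sq_sqrt (mul_nonneg (by norm_num) (div_nonneg (ht i) hτ.le))
    simp only [this, Finset.card_univ, Fintype.card_fin]
    rw [← Finset.mul_sum, ← Finset.sum_div]
    ring

end CNN

/-! ### Margin and ramp loss -/

section Loss

variable {k : ℕ}

/-- The score at `y` and the best competing score are each 1-Lipschitz. Two classes guarantee that a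
competitor exists, so the supremum is not a default value. -/
lemma abs_margin_sub_le (hk : 2 ≤ k) (v v' : Vec k) (y : Fin k) :
    |margin v y - margin v' y| ≤ 2 * ‖v - v'‖ := by
  have hcoord : ∀ (u u' : Vec k) j, u j ≤ u' j + ‖u - u'‖ := by
    intro u u' j
    have h := PiLp.norm_apply_le (u - u') j
    rw [PiLp.sub_apply] at h
    linarith [le_abs_self (u j - u' j), Real.norm_eq_abs (u j - u' j)]
  have : Nontrivial (Fin k) := Fin.nontrivial_iff_two_le.2 hk
  have hne : Nonempty {j : Fin k // j ≠ y} := by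
    obtain ⟨j, hj⟩ := exists_ne y
    exact ⟨⟨j, hj⟩⟩
  have hsup : ∀ u u' : Vec k,
      (⨆ j : {j : Fin k // j ≠ y}, u j) ≤ (⨆ j : {j : Fin k // j ≠ y}, u' j) + ‖u - u'‖ := by
    intro u u'
    refine ciSup_le fun j => (hcoord u u' j).trans ?_
    gcongr
    exact le_ciSup (f := fun j : {j : Fin k // j ≠ y} => u' j) (Set.finite_range _).bddAbove j
  have h1 := hcoord v v' y
  have h2 := hcoord v' v y
  have h3 := hsup v v'
  have h4 := hsup v' v
  rw [norm_sub_rev v' v] at h2 h4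
  rw [abs_le]
  simp only [margin]
  constructor <;> linarith

/-- As a clipped affine function, the ramp is visibly `1/η`-Lipschitz with values in `[0, 1]`. -/
lemma ramp_eq {η : ℝ} (hη : 0 < η) (r : ℝ) : ramp η r = max 0 (min 1 (1 + r / η)) := by
  unfold ramp
  split_ifs with h1 h2
  · have : r / η < -1 := by rw [div_lt_iff₀ hη]; linarith
    rw [max_eq_left]
    exact (min_le_right _ _).trans (by linarith)
  · have h3 : -1 ≤ r / η := by rw [le_div_iff₀ hη]; linarith
    have h4 : r / η ≤ 0 := div_nonpos_of_nonpos_of_nonneg h2 hη.le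
    rw [min_eq_right (by linarith), max_eq_right (by linarith)]
  · have h4 : 0 ≤ r / η := div_nonneg (by linarith) hη.le
    rw [min_eq_left (by linarith), max_eq_right zero_le_one]

lemma abs_ramp_sub_le {η : ℝ} (hη : 0 < η) (r r' : ℝ) : |ramp η r - ramp η r'| ≤ |r - r'| / η := by
  rw [ramp_eq hη, ramp_eq hη, max_comm 0, max_comm 0, min_comm 1, min_comm 1]
  refine (abs_max_sub_max_le_abs _ _ _).trans ((abs_inf_sub_inf_le_abs _ _ _).trans_eq ?_)
  rw [add_sub_add_left_eq_sub, ← sub_div, abs_div, abs_of_pos hη]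

lemma rampLoss_nonneg {η : ℝ} (hη : 0 < η) (v : Vec k) (y : Fin k) : 0 ≤ rampLoss η v y := by
  rw [rampLoss, ramp_eq hη]
  exact le_max_left _ _

lemma rampLoss_le_one {η : ℝ} (hη : 0 < η) (v : Vec k) (y : Fin k) : rampLoss η v y ≤ 1 := by
  rw [rampLoss, ramp_eq hη]
  exact max_le zero_le_one (min_le_left _ _)

lemma abs_rampLoss_sub_le (hk : 2 ≤ k) {η : ℝ} (hη : 0 < η) (v v' : Vec k) (y : Fin k) :
    |rampLoss η v y - rampLoss η v' y| ≤ 2 / η * ‖v - v'‖ := by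
  refine (abs_ramp_sub_le hη _ _).trans ?_
  rw [neg_sub_neg, abs_sub_comm, div_mul_eq_mul_div]
  gcongr
  exact abs_margin_sub_le hk v v' y

lemma one_le_rampLoss_of_misclassified {η : ℝ} (hη : 0 < η) {v : Vec k} {y : Fin k}
    (h : Misclassified v y) : 1 ≤ rampLoss η v y := by
  obtain ⟨j, hj, hle⟩ := h
  have h1 : v j ≤ ⨆ j : {j : Fin k // j ≠ y}, v j :=
    le_ciSup (f := fun j : {j : Fin k // j ≠ y} => v j) (Set.finite_range _).bddAbove ⟨j, hj⟩
  have h2 : 0 ≤ -margin v y := by simp only [margin]; linarith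
  rw [rampLoss, ramp_eq hη, min_eq_left]
  · exact le_max_right _ _
  · linarith [div_nonneg h2 hη.le]

lemma continuous_rampLoss (hk : 2 ≤ k) {η : ℝ} (hη : 0 < η) (y : Fin k) :
    Continuous fun v : Vec k => rampLoss η v y := by
  refine (LipschitzWith.of_dist_le_mul (K := ⟨2 / η, by positivity⟩) fun v v' => ?_).continuous
  rw [Real.dist_eq, dist_eq_norm]
  exact abs_rampLoss_sub_le hk hη v v' y

lemma measurable_rampLoss_comp {d : ℕ} (hk : 2 ≤ k) {η : ℝ} (hη : 0 < η) {f : Vec d → Vec k}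
    (hf : Continuous f) : Measurable fun z : Vec d × Fin k => rampLoss η (f z.1) z.2 :=
  measurable_from_prod_countable_left fun y => ((continuous_rampLoss hk hη y).comp hf).measurable

lemma risk_le_integral {d : ℕ} (hk : 2 ≤ k) {η : ℝ} (hη : 0 < η) {f : Vec d → Vec k}
    (hf : Continuous f) (D : Measure (Vec d × Fin k)) [IsProbabilityMeasure D] :
    risk D f ≤ ∫ z, rampLoss η (f z.1) z.2 ∂D := by
  have hint : Integrable (fun z : Vec d × Fin k => rampLoss η (f z.1) z.2) D :=
    integrable_of_abs_le (M := 1) (measurable_rampLoss_comp hk hη hf) fun z => by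
      rw [abs_of_nonneg (rampLoss_nonneg hη _ _)]; exact rampLoss_le_one hη _ _
  have h := mul_meas_ge_le_integral_of_nonneg (μ := D)
    (Filter.Eventually.of_forall fun z => rampLoss_nonneg hη _ _) hint 1
  rw [one_mul] at h
  exact (measureReal_mono fun z hz => one_le_rampLoss_of_misclassified hη hz).trans h

end Loss

/-! ### Assembly of the bound -/

lemma frobNorm_inputMatrix {d k n : ℕ} (Z : Fin n → Vec d × Fin k) :
    frobNorm (inputMatrix Z) = √(∑ i, ‖(Z i).1‖ ^ 2) := by
  rw [← Real.sqrt_sq (frobNorm_nonneg (inputMatrix Z)), frobNorm_sq, Finset.sum_comm]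
  simp only [EuclideanSpace.real_norm_sq_eq]
  rfl

/-- Rounding `8` up to `2^4` makes the fourth root equal to `2`. The exponent arises as `1/2 - 1/8 =
1 - 5/8`. -/
lemma sqrt_sqrt_eight_mul_le {n : ℕ} (hn : 0 < n) {x : ℝ} (hx : 0 ≤ x) :
    √n * √(√(8 * x / √n)) ≤ 2 * (n * (x ^ (1 / 4 : ℝ) * (n : ℝ) ^ (-(5 / 8) : ℝ))) := by
  have hn' : (0 : ℝ) < n := by exact_mod_cast hn
  have h16 : √(√(8 * x / √n)) ≤ √(√(2 ^ 4 * (x / √n))) := by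
    gcongr
    rw [mul_div_assoc]
    gcongr
    norm_num
  refine (mul_le_mul_of_nonneg_left h16 (Real.sqrt_nonneg _)).trans_eq ?_
  have e1 : √(√((2 : ℝ) ^ 4 * (x / √n))) = 2 * √(√(x / √n)) := by
    rw [show (2 : ℝ) ^ 4 = (2 ^ 2) ^ 2 by norm_num, Real.sqrt_mul (by positivity),
      Real.sqrt_sq (by positivity), Real.sqrt_mul (by positivity), Real.sqrt_sq (by positivity)]
  have e2 : √(√(x / √n)) = x ^ (1 / 4 : ℝ) * (n : ℝ) ^ (-(1 / 8) : ℝ) := by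
    simp only [Real.sqrt_eq_rpow]
    rw [← Real.rpow_mul (by positivity), Real.div_rpow hx (by positivity),
      ← Real.rpow_mul hn'.le, div_eq_mul_inv, ← Real.rpow_neg hn'.le]
    norm_num
  have e3 : √(n : ℝ) * (n : ℝ) ^ (-(1 / 8) : ℝ) = n * (n : ℝ) ^ (-(5 / 8) : ℝ) := by
    have e4 : (n : ℝ) * (n : ℝ) ^ (-(5 / 8) : ℝ) = (n : ℝ) ^ (1 : ℝ) * (n : ℝ) ^ (-(5 / 8) : ℝ) := by
      rw [Real.rpow_one]
    rw [e4, Real.sqrt_eq_rpow, ← Real.rpow_add hn', ← Real.rpow_add hn']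
    norm_num
  rw [e1, e2]
  linear_combination 2 * x ^ (1 / 4 : ℝ) * e3

lemma CNN.sensitiveComplexity_nonneg {L : ℕ} {N : CNN L} (ρ : Fin L → ℝ≥0) {a s : Fin L → ℝ}
    (hs : ∀ i, 0 < s i) {w : N.Weights} (hw : N.Admissible a s w) :
    0 ≤ N.sensitiveComplexity ρ a s := by
  have h1 : 0 ≤ ∏ i, (ρ i : ℝ) * s i := Finset.prod_nonneg fun i _ => mul_nonneg (ρ i).coe_nonneg (hs i).le
  have h2 : 0 ≤ ∑ i, (N.layer i).term (a i) (s i) := Finset.sum_nonneg fun i _ =>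
    (N.layer i).term_nonneg (((N.layer i).weightNorm_nonneg _).trans (hw i).1) (hs i).le
  unfold sensitiveComplexity
  positivity

/-- Entropy bound for the ramp losses of a class of networks. -/
lemma CNN.exists_loss_net {L : ℕ} (hL : 0 < L) {N : CNN L} (hk : 2 ≤ N.classes) {ρ : Fin L → ℝ≥0}
    (hLip : ∀ i, LipschitzWith (ρ i) (N.act i)) (hzero : ∀ i, N.act i 0 = 0) {a s : Fin L → ℝ}
    (hs : ∀ i, 0 < s i) {w₀ : N.Weights} (hw₀ : N.Admissible a s w₀) {η : ℝ} (hη : 0 < η)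
    {ε : ℝ} (hε : 0 < ε) :
    ∃ T : Finset {w : N.Weights // N.Admissible a s w},
      (∀ θ : {w : N.Weights // N.Admissible a s w}, ∃ θ' ∈ T, ∀ z : Vec N.inDim × Fin N.classes,
        |rampLoss η (N.eval θ.1 z.1) z.2 - rampLoss η (N.eval θ'.1 z.1) z.2| ≤ ε * ‖z.1‖) ∧
      Real.log T.card ≤ √(8 * N.sensitiveComplexity ρ a s / η / ε) := by
  classical
  have hL' : (0 : ℝ) < L := by exact_mod_cast hL
  set P := ∏ j, (ρ j : ℝ) * s j with hP
  have hP0 : 0 ≤ P := Finset.prod_nonneg fun i _ => mul_nonneg (ρ i).coe_nonneg (hs i).le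
  -- If the product is `0`, all admissible networks vanish identically and one point suffices; the
  -- scale `τ` below would divide by zero.
  rcases hP0.eq_or_lt with hz | hpos
  · refine ⟨{⟨w₀, hw₀⟩}, fun θ => ⟨_, Finset.mem_singleton_self _, fun z => ?_⟩, by simp⟩
    have h0 : ∀ w, N.Admissible a s w → N.eval w z.1 = 0 := by
      intro w hw
      have := N.norm_layerOutput_le hLip hs hzero hw z.1 (Fin.last L)
      rw [lipProd_last, ← hP, ← hz, zero_mul] at this
      exact norm_le_zero_iff.1 this
    rw [h0 _ θ.2, h0 _ hw₀, sub_self, abs_zero]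
    positivity
  -- Chosen so that the ramp's `2/η` times the network error `P L τ ‖x‖` equals `ε ‖x‖`.
  · set τ := η * ε / (2 * P * L) with hτ
    have hτ0 : 0 < τ := by positivity
    obtain ⟨T, hT, hcov, hlog⟩ := exists_net hs hτ0 hw₀
    refine ⟨T.subtype _, fun θ => ?_, ?_⟩
    · obtain ⟨w', hw', hd⟩ := hcov θ.1 θ.2
      refine ⟨⟨w', hT w' hw'⟩, Finset.mem_subtype.2 hw', fun z => ?_⟩
      have h := N.norm_layerOutput_sub_le hLip hs hzero θ.2 (hT w' hw') hd z.1 (Fin.last L)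
      rw [lipProd_last, ← hP, Fin.val_last] at h
      refine (abs_rampLoss_sub_le hk hη _ _ _).trans
        ((mul_le_mul_of_nonneg_left h (by positivity)).trans_eq ?_)
      rw [hτ]; field_simp
    · rw [Finset.card_subtype, Finset.filter_true_of_mem hT]
      refine hlog.trans_eq ?_
      congr 1
      rw [hτ, sensitiveComplexity, ← hP]
      field_simp

end ConvNet

/-- Generalization bound for convolutional neural networks. The constant `C` is universal; the
bound holds simultaneously for all networks with the given architecture and norm constraints,
outside an event of probability at most `δ`. -/
theorem theorem2 :
    ∃ C : ℝ, 0 < C ∧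
      ∀ (L : ℕ) (_hL : 0 < L) (N : ConvNet.CNN L) (_hk : 2 ≤ N.classes)
        (ρ : Fin L → ℝ≥0) (_hLip : ∀ i, LipschitzWith (ρ i) (N.act i))
        (_hzero : ∀ i, N.act i 0 = 0)
        (a s : Fin L → ℝ) (_hs : ∀ i, 0 < s i)
        (D : Measure (ConvNet.Vec N.inDim × Fin N.classes)) (_hD : IsProbabilityMeasure D)
        (n : ℕ) (_hn : 0 < n) (η : ℝ) (_hη : 0 < η) (δ : ℝ) (_hδ : 0 < δ) (_hδ1 : δ < 1),
        Measure.pi (fun _ : Fin n => D)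
          {Z | ¬ ∀ w : N.Weights, N.Admissible a s w →
            ConvNet.risk D (N.eval w) ≤ ConvNet.empRampRisk η Z (N.eval w) +
              C * ((ConvNet.frobNorm (ConvNet.inputMatrix Z) *
                      N.sensitiveComplexity ρ a s / η) ^ (1 / 4 : ℝ) *
                    (n : ℝ) ^ (-(5 / 8) : ℝ) +
                  Real.sqrt (Real.log (1 / δ) / n))}
          ≤ ENNReal.ofReal δ := by

  -- `20 = 2 · 5 · 2`: symmetrization, chaining, and the fourth root of `16`. The concentration term
  -- needs only `3`.
  refine ⟨20, by norm_num, ?_⟩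
  intro L hL N hk ρ hLip hzero a s hs D hD n hn η hη δ hδ hδ1
  have hn' : (0 : ℝ) < n := by exact_mod_cast hn
  by_cases hne : ∃ w₀ : N.Weights, N.Admissible a s w₀
  swap
  -- Without admissible weights the bad event is empty; otherwise the class of losses is nonempty,
  -- as the nets require.
  · push Not at hne
    simp [hne]
  obtain ⟨w₀, hw₀⟩ := hne
  have : Nonempty {w : N.Weights // N.Admissible a s w} := ⟨⟨w₀, hw₀⟩⟩
  have hcont : ∀ w : N.Weights, Continuous (N.eval w) := ConvNet.CNN.continuous_eval hLip
  have key := ConvNet.measure_exists_gt_le (D := D) (n := n)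
    (ℓ := fun (θ : {w : N.Weights // N.Admissible a s w}) z =>
      ConvNet.rampLoss η (N.eval θ.1 z.1) z.2)
    (h := fun z => ‖z.1‖) (B := 8 * N.sensitiveComplexity ρ a s / η) hn
    (fun θ => ConvNet.measurable_rampLoss_comp hk hη (hcont θ.1))
    (fun θ z => ConvNet.rampLoss_nonneg hη _ _) (fun θ z => ConvNet.rampLoss_le_one hη _ _)
    (fun ε hε => ConvNet.CNN.exists_loss_net hL hk hLip hzero hs hw₀ hη hε) hδ hδ1
  refine (measure_mono fun Z hZ => ?_).trans key
  simp only [Set.mem_ofPred_eq, not_forall, not_le] at hZ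
  obtain ⟨w, hw, hlt⟩ := hZ
  refine ⟨⟨w, hw⟩, ?_⟩
  have hR := ConvNet.CNN.sensitiveComplexity_nonneg ρ hs hw
  have hrisk := ConvNet.risk_le_integral hk hη (hcont w) D
  have hx : 0 ≤ ConvNet.frobNorm (ConvNet.inputMatrix Z) * N.sensitiveComplexity ρ a s / η :=
    div_nonneg (mul_nonneg (ConvNet.frobNorm_nonneg _) hR) hη.le
  have hent := ConvNet.sqrt_sqrt_eight_mul_le hn hx
  have hdev : n * √(Real.log (1 / δ) / n) = √(n * Real.log (1 / δ)) := by
    rw [show (n : ℝ) * Real.log (1 / δ) = (n : ℝ) ^ 2 * (Real.log (1 / δ) / n) by field_simp,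
      Real.sqrt_mul (by positivity), Real.sqrt_sq hn'.le]
  have hemp : n * ConvNet.empRampRisk η Z (N.eval w)
      = ∑ i, ConvNet.rampLoss η (N.eval w (Z i).1) (Z i).2 := by
    rw [ConvNet.empRampRisk]; field_simp
  have hB : 8 * N.sensitiveComplexity ρ a s / η * √(∑ i, ‖(Z i).1‖ ^ 2)
      = 8 * (ConvNet.frobNorm (ConvNet.inputMatrix Z) * N.sensitiveComplexity ρ a s / η) := by
    rw [ConvNet.frobNorm_inputMatrix]; ring
  simp only [Finset.sum_sub_distrib, Finset.sum_const, Finset.card_univ, Fintype.card_fin,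
    nsmul_eq_mul]
  rw [hB, ← hemp]
  have hlt' := mul_lt_mul_of_pos_left (hlt.trans_le hrisk) hn'
  rw [mul_add, mul_left_comm, mul_add (n : ℝ), hdev] at hlt'
  have h0 : 0 ≤ √(n * Real.log (1 / δ)) := Real.sqrt_nonneg _
  linarith
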